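/- **Theorem 2.1.** Let $M$ be a connected, closed, smooth Riemannian manifold, let $T\in(0,\infty]$, and let $|\cdot|=|\cdot|_x$ also denote the norm on the cotangent space $T_x^*M$ dual to the Riemannian norm on $T_xM$. Let $H=H(x,p,u)$ be a real-valued function defined for $(x,p)\in T^*M$ and $u\in\mathbb R$ such that - (H1) $(x,p,u)\mapsto H(x,p,u)$ is continuous on $T^*M\times\mathbb R$; - (H2) for any $R>0$ there exists $K>0$ such that $H(x,p,u)>R$ whenever $|u|\le R$ and $|p|\ge K$; - (H3) for any $(x,u)\in M\times\mathbb R$, the function $p\mapsto H(x,p,u)$ is convex on $T_x^*M$; - (H4) there is $\Lambda>0$ such that $|H(x,p,u)-H(x,p,v)|\le\Lambda|u-v|$ for all $(x,p)\in T^*M$ and $u,v\in\mathbb R$. A lower semicontinuous function $u:M\times(0,T)\to\mathbb R\cup\{\infty\}$ is called a Barron–Jensen (BJ) subsolution (resp., supersolution) of $$u_t+H(x,D_xu,u)=0\quad\text{in } M\times(0,T)\qquad(*)$$ if, whenever $\phi\in C^1(M\times(0,T),\mathbb R)$, $(x,t)\in M\times(0,T)$, $u(x,t)<\infty$ and $u-\phi$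 attains its minimum over $M\times(0,T)$ at $(x,t)$, we have $\phi_t(x,t)+H(x,D_x\phi(x,t),u(x,t))\le 0$ (resp., $\ge 0$). Let $v,w:M\times[0,T)\to\mathbb R\cup\{\infty\}$ be lower semicontinuous functions on $M\times[0,T)$ whose restrictions to $M\times(0,T)$ are, respectively, a BJ subsolution and a BJ supersolution of $(*)$. Assume that $$w(x,0)\ \ge\ \liminf_{t\to0+}v(x,t)\qquad\text{for all } x\in M.$$ Then $v\le w$ on $M\times[0,T)$. -/

import Mathlib

open Set Filter Topology Bundle
open scoped Manifold ContDiff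

/-- The cotangent space `T*_x M`: the dual of the tangent space. When `M` carries a Riemannian
metric, its norm is the operator norm for the Riemannian norm on `T_x M`. -/
abbrev CotSpace (n : ℕ) (M : Type*) [TopologicalSpace M]
    [ChartedSpace (EuclideanSpace ℝ (Fin n)) M] (x : M) : Type :=
  TangentSpace (𝓡 n) x →L[ℝ] Bundle.Trivial M ℝ x

/-- The cotangent bundle `T*M`, with the vector bundle topology of Mathlib's bundle of continuous
linear maps from the tangent bundle to the trivial line bundle. -/
abbrev CotBundle (n : ℕ) (M : Type*) [TopologicalSpace M]
    [ChartedSpace (EuclideanSpace ℝ (Fin n)) M] : Type _ :=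
  TotalSpace (EuclideanSpace ℝ (Fin n) →L[ℝ] ℝ) (CotSpace n M)

section Hamiltonian

variable {n : ℕ} {M : Type*} [TopologicalSpace M] [ChartedSpace (EuclideanSpace ℝ (Fin n)) M]

/-- `(x, p, u) ↦ H(x, p, u)` is continuous on `T*M × ℝ`. -/
def HamContinuous [IsManifold (𝓡 n) ∞ M] (H : (x : M) → CotSpace n M x → ℝ → ℝ) : Prop :=
  Continuous fun q : CotBundle n M × ℝ => H q.1.proj q.1.snd q.2

/-- For every `R > 0` there is `K > 0` with `H(x, p, u) > R` whenever `|u| ≤ R` and `|p| ≥ K`. -/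
def HamCoercive [RiemannianBundle (fun x : M => TangentSpace (𝓡 n) x)]
    (H : (x : M) → CotSpace n M x → ℝ → ℝ) : Prop :=
  ∀ R : ℝ, 0 < R → ∃ K : ℝ, 0 < K ∧
    ∀ (x : M) (p : CotSpace n M x) (u : ℝ), |u| ≤ R → K ≤ ‖p‖ → R < H x p u

/-- For every `(x, u)`, the function `p ↦ H(x, p, u)` is convex on `T*_x M`. -/
def HamConvex (H : (x : M) → CotSpace n M x → ℝ → ℝ) : Prop :=
  ∀ (x : M) (u : ℝ), ConvexOn ℝ univ fun p : CotSpace n M x => H x p u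

/-- The functions `u ↦ H(x, p, u)` are Lipschitz with a common constant `Λ > 0`. -/
def HamLipschitz (H : (x : M) → CotSpace n M x → ℝ → ℝ) : Prop :=
  ∃ Λ : ℝ, 0 < Λ ∧ ∀ (x : M) (p : CotSpace n M x) (u v : ℝ),
    |H x p u - H x p v| ≤ Λ * |u - v|

end Hamiltonian

/-- `M × (0, T)`, where `T` may be `+∞`. -/
def openCyl (M : Type*) (T : EReal) : Set (M × ℝ) := {z | 0 < z.2 ∧ (z.2 : EReal) < T}

/-- `M × [0, T)`, where `T` may be `+∞`. -/
def halfOpenCyl (M : Type*) (T : EReal) : Set (M × ℝ) := {z | 0 ≤ z.2 ∧ (z.2 : EReal) < T}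

/-- `u ∈ LSC(S, ℝ ∪ {∞})`: on `S`, `u` is lower semicontinuous and never takes the value `-∞`.
Values of `u` outside `S` play no role. -/
def IsLSC {X : Type*} [TopologicalSpace X] (u : X → EReal) (S : Set X) : Prop :=
  LowerSemicontinuousOn u S ∧ ∀ z ∈ S, u z ≠ ⊥

section Solutions

variable {n : ℕ} {M : Type*} [TopologicalSpace M] [ChartedSpace (EuclideanSpace ℝ (Fin n)) M]

/-- `φ ∈ C¹(M × (0, T), ℝ)`. Since `M × (0, T)` is open, this is expressed with functions on
`M × ℝ` whose values outside `M × (0, T)` play no role. -/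
def IsTestFun (n : ℕ) {M : Type*} [TopologicalSpace M] [ChartedSpace (EuclideanSpace ℝ (Fin n)) M]
    (T : EReal) (φ : M × ℝ → ℝ) : Prop :=
  ContMDiffOn ((𝓡 n).prod 𝓘(ℝ, ℝ)) 𝓘(ℝ, ℝ) 1 φ (openCyl M T)

/-- The differential `D_x φ(x, t) ∈ T*_x M` in the space variable. -/
noncomputable def spaceDiff (n : ℕ) {M : Type*} [TopologicalSpace M]
    [ChartedSpace (EuclideanSpace ℝ (Fin n)) M] (φ : M × ℝ → ℝ) (x : M) (t : ℝ) :
    CotSpace n M x :=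
  mfderiv (𝓡 n) 𝓘(ℝ, ℝ) (fun y : M => φ (y, t)) x

/-- The partial derivative `φ_t(x, t)`. -/
noncomputable def timeDeriv {M : Type*} (φ : M × ℝ → ℝ) (x : M) (t : ℝ) : ℝ :=
  deriv (fun s : ℝ => φ (x, s)) t

/-- Barron–Jensen subsolution of `u_t + H(x, D_x u, u) = 0` in `M × (0, T)`: at every point where
`u` is finite and where `u - φ` attains its minimum over `M × (0, T)`, `φ` being a `C¹` test
function, one has `φ_t + H(x, D_x φ, u) ≤ 0`. -/
def IsBJSubsolution (H : (x : M) → CotSpace n M x → ℝ → ℝ) (T : EReal) (u : M × ℝ → EReal) :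
    Prop :=
  IsLSC u (openCyl M T) ∧
    ∀ φ : M × ℝ → ℝ, IsTestFun n T φ →
      ∀ (x : M) (t : ℝ), (x, t) ∈ openCyl M T →
        IsMinOn (fun z => u z - (φ z : EReal)) (openCyl M T) (x, t) →
          ∀ r : ℝ, u (x, t) = (r : EReal) →
            timeDeriv φ x t + H x (spaceDiff n φ x t) r ≤ 0

/-- Barron–Jensen supersolution of `u_t + H(x, D_x u, u) = 0` in `M × (0, T)`: same as for a
subsolution (the test functions again touch from below), with the conclusion
`φ_t + H(x, D_x φ, u) ≥ 0`. -/
def IsBJSupersolution (H : (x : M) → CotSpace n M x → ℝ → ℝ) (T : EReal) (u : M × ℝ → EReal) :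
    Prop :=
  IsLSC u (openCyl M T) ∧
    ∀ φ : M × ℝ → ℝ, IsTestFun n T φ →
      ∀ (x : M) (t : ℝ), (x, t) ∈ openCyl M T →
        IsMinOn (fun z => u z - (φ z : EReal)) (openCyl M T) (x, t) →
          ∀ r : ℝ, u (x, t) = (r : EReal) →
            0 ≤ timeDeriv φ x t + H x (spaceDiff n φ x t) r

end Solutions

/-! Both notions test from below, whereas comparison by doubling variables touches the subsolution
from above. Convexity of `H` in the momentum removes this mismatch. Near a given point, all proximal
subgradients of a Lipschitz subsolution `V` lie in a closed convex set of almost admissible slopes.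
If a slope touching `V` from above were, in the limit, outside this set, some direction `e` would
separate it from the set. The mean value inequality `le_add_of_proxSubgrad_inner_lt` would then
bound the growth of `V` along `e` too strictly for such a touching. `exists_common_slope` combines
this with doubling, the supersolution being tested by an ordinary proximal subgradient.

The Lipschitz bound comes from an inf-convolution in time
(`IsProxSubsolution.exists_regularization`). It bounds the time slopes, so the equation bounds `H`
from above along subgradients and coercivity bounds the space slopes. `IsProxSubsolution.sub_mul_le`
compares the regularised subsolution with a supersolution by maximising their difference times a
weight in time. That weight turns the touching into a contradiction with the Lipschitz dependence on
`u`. The regularisation parameter is then sent to zero, using lower semicontinuity of the original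
subsolution.

The initial condition involves only a liminf. Coercivity and compactness of `M` bound `H` below on
bounded values of `u`, so a bounded subsolution grows at most linearly in time. A smallness along
some times tending to zero therefore controls all small times.

Infinite and unbounded values are removed by truncation: `v` becomes the minimum of `v` and a large
subsolution depending on time only, `w` becomes the minimum of `w` and a constant. Proximal
inequalities in charts replace the global definition throughout; `exists_isTestFun` links the two.
-/

section ProximalCalculus

/-! ### Proximal subgradients: mean value inequality and doubling of variables. -/

open Metric

variable {Z : Type*} [NormedAddCommGroup Z] [InnerProductSpace ℝ Z]

/-- `ξ` is a proximal subgradient of `u` at `z`. -/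
def IsProxSubgrad (u : Z → ℝ) (z ξ : Z) : Prop :=
  ∃ σ : ℝ, ∀ᶠ z' in 𝓝 z, u z + inner ℝ ξ (z' - z) - σ * ‖z' - z‖ ^ 2 ≤ u z'

theorem norm_sq_sub_norm_sq (a b : Z) :
    ‖b‖ ^ 2 - ‖a‖ ^ 2 = 2 * inner ℝ a (b - a) + ‖b - a‖ ^ 2 := by
  have h := norm_add_sq_real a (b - a)
  rw [add_sub_cancel] at h
  linarith

/-- A lower semicontinuous function whose proximal subgradients `ξ` all satisfy `⟪ξ, e⟫ < ρ` grows
by at most `ρ` along a segment of direction `e`. -/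
theorem le_add_of_proxSubgrad_inner_lt [FiniteDimensional ℝ Z] {u : Z → ℝ} {U : Set Z} {y e : Z}
    {ρ : ℝ} (hU : IsOpen U)
    (hu : LowerSemicontinuousOn u U) (hseg : segment ℝ y (y + e) ⊆ U)
    (h : ∀ z ∈ U, ∀ ξ, IsProxSubgrad u z ξ → inner ℝ ξ e < ρ) : u (y + e) ≤ u y + ρ := by
  by_contra! hlt
  have hSc : IsCompact (segment ℝ y (y + e)) := by
    rw [segment_eq_image']
    exact isCompact_Icc.image (by fun_prop)
  obtain ⟨δ, hδ, hδU⟩ := hSc.exists_cthickening_subset_open hU hseg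
  set K := cthickening δ (segment ℝ y (y + e)) with hK
  have hKc : IsCompact K := hSc.cthickening
  have hyK : y ∈ K := self_subset_cthickening _ (left_mem_segment ℝ y (y + e))
  have huK : LowerSemicontinuousOn u K := hu.mono hδU
  obtain ⟨zm, hzm, hmin⟩ := huK.exists_isMinOn ⟨y, hyK⟩ hKc
  have hye : y + e ∈ U := hseg (right_mem_segment ℝ _ _)
  have hlsc := hu _ hye _ hlt
  rw [hU.nhdsWithin_eq hye] at hlsc
  obtain ⟨ε, hε, hεu⟩ := Metric.eventually_nhds_iff_ball.1 hlsc
  set ε' := min δ ε with hε'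
  have hε'0 : 0 < ε' := lt_min hδ hε
  -- `A` exceeds the largest penalty that a minimiser of the functional below can carry, so `k * ε'
  -- ^ 2 = A` keeps that minimiser within `ε'` of the segment.
  set A := u y - u zm + |ρ| + 1 with hA
  have hyzm : u zm ≤ u y := hmin hyK
  have hA0 : 0 < A := by linarith [abs_nonneg ρ]
  set k := A / ε' ^ 2 with hk
  have hk0 : 0 < k := by positivity
  have hkε : k * ε' ^ 2 = A := by rw [hk]; field_simp
  -- The base point `y + q.1 • e` moves along the segment and is rewarded at rate `ρ`. At a
  -- minimiser, variation in space yields a proximal subgradient, and moving the base point forward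
  -- shows that its pairing with `e` is at least `ρ`.
  have hF : LowerSemicontinuousOn
      (fun q : ℝ × Z => u q.2 + (k * ‖q.2 - (y + q.1 • e)‖ ^ 2 - q.1 * ρ)) (Icc 0 1 ×ˢ K) := by
    refine LowerSemicontinuousOn.add ?_ ((Continuous.lowerSemicontinuous ?_).lowerSemicontinuousOn _)
    · exact huK.comp continuous_snd.continuousOn fun q hq => hq.2
    · fun_prop
  obtain ⟨⟨t, ζ⟩, ⟨ht, hζ⟩, hmin2⟩ := hF.exists_isMinOn
    (show (Icc (0 : ℝ) 1 ×ˢ K).Nonempty from ⟨(0, y), by simp, hyK⟩) (isCompact_Icc.prod hKc)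
  have hζm : u zm ≤ u ζ := hmin hζ
  have h0 : u ζ + (k * ‖ζ - (y + t • e)‖ ^ 2 - t * ρ) ≤ u y := by
    have := hmin2 (show ((0 : ℝ), y) ∈ Icc (0 : ℝ) 1 ×ˢ K from ⟨by simp, hyK⟩)
    simpa using this
  have htρ : t * ρ ≤ |ρ| := by
    calc t * ρ ≤ t * |ρ| := mul_le_mul_of_nonneg_left (le_abs_self ρ) ht.1
      _ ≤ 1 * |ρ| := mul_le_mul_of_nonneg_right ht.2 (abs_nonneg ρ)
      _ = |ρ| := one_mul _
  have hd : ‖ζ - (y + t • e)‖ < ε' := by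
    have : k * ‖ζ - (y + t • e)‖ ^ 2 < k * ε' ^ 2 := by rw [hkε]; linarith
    exact lt_of_pow_lt_pow_left₀ 2 hε'0.le (lt_of_mul_lt_mul_left this hk0.le)
  have hζK : K ∈ 𝓝 ζ := by
    have hmem : y + t • e ∈ segment ℝ y (y + e) := by
      rw [segment_eq_image']
      exact ⟨t, ht, by simp⟩
    have : ζ ∈ thickening δ (segment ℝ y (y + e)) :=
      mem_thickening_iff.2 ⟨_, hmem, by rw [dist_eq_norm]; exact hd.trans_le (min_le_left _ _)⟩
    exact mem_of_superset (isOpen_thickening.mem_nhds this) (thickening_subset_cthickening _ _)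
  -- At `t = 1` the minimiser would be so close to `y + e` that lower semicontinuity makes the
  -- functional exceed its value `u y` at `(0, y)`.
  have ht1 : t < 1 := by
    refine lt_of_le_of_ne ht.2 fun ht1 => ?_
    subst ht1
    have h1 : ζ ∈ ball (y + e) ε := by
      rw [mem_ball, dist_eq_norm]
      simpa using hd.trans_le (min_le_right _ _)
    have h2 := hεu ζ h1
    have h3 : 0 ≤ k * ‖ζ - (y + (1 : ℝ) • e)‖ ^ 2 := by positivity
    linarith
  set a := ζ - (y + t • e) with ha
  have hprox : IsProxSubgrad u ζ ((-2 * k) • a) := by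
    refine ⟨k, ?_⟩
    filter_upwards [hζK] with z' hz'
    have h1 := hmin2 (show (t, z') ∈ Icc (0 : ℝ) 1 ×ˢ K from ⟨ht, hz'⟩)
    have h2 := norm_sq_sub_norm_sq a (z' - (y + t • e))
    have h3 : z' - (y + t • e) - a = z' - ζ := by rw [ha]; abel
    rw [h3] at h2
    have h1' : u ζ + (k * ‖a‖ ^ 2 - t * ρ) ≤ u z' + (k * ‖z' - (y + t • e)‖ ^ 2 - t * ρ) := h1
    rw [real_inner_smul_left]
    nlinarith
  have hin := h ζ (hδU hζ) _ hprox
  rw [real_inner_smul_left] at hin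
  set g := ρ - -2 * k * inner ℝ a e with hg
  have hg0 : 0 < g := by linarith
  set s := min (1 - t) (g / (2 * (k * ‖e‖ ^ 2 + 1))) with hs
  have hs0 : 0 < s := lt_min (by linarith) (by positivity)
  have hs1 : s * (k * ‖e‖ ^ 2 + 1) ≤ g / 2 := by
    calc s * (k * ‖e‖ ^ 2 + 1) ≤ g / (2 * (k * ‖e‖ ^ 2 + 1)) * (k * ‖e‖ ^ 2 + 1) :=
          mul_le_mul_of_nonneg_right (min_le_right _ _) (by positivity)
      _ = g / 2 := by field_simp
  have h1 := hmin2 (show (t + s, ζ) ∈ Icc (0 : ℝ) 1 ×ˢ K from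
    ⟨⟨by linarith [ht.1], by linarith [min_le_left (1 - t) (g / (2 * (k * ‖e‖ ^ 2 + 1)))]⟩, hζ⟩)
  have h1' : u ζ + (k * ‖a‖ ^ 2 - t * ρ) ≤
      u ζ + (k * ‖ζ - (y + (t + s) • e)‖ ^ 2 - (t + s) * ρ) := h1
  have h2 : ζ - (y + (t + s) • e) = a - s • e := by rw [ha]; module
  rw [h2, norm_sub_sq_real a (s • e), real_inner_smul_right, norm_smul, mul_pow, Real.norm_eq_abs,
    sq_abs] at h1'
  have h3 : s * g ≤ s * (s * (k * ‖e‖ ^ 2)) := by rw [hg]; linarith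
  have h4 := le_of_mul_le_mul_left h3 hs0
  linarith

/-- Cauchy–Schwarz feeds the mean value inequality; the slack `ε` supplies its strict hypothesis.
Exchanging the two points gives the Lipschitz estimate. -/
theorem le_add_mul_norm_of_proxSubgrad_norm_le [FiniteDimensional ℝ Z] {u : Z → ℝ} {U : Set Z}
    {L : ℝ} (hU : IsOpen U) (hconv : Convex ℝ U) (hu : LowerSemicontinuousOn u U)
    (h : ∀ z ∈ U, ∀ ξ, IsProxSubgrad u z ξ → ‖ξ‖ ≤ L) {y z : Z} (hy : y ∈ U) (hz : z ∈ U) :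
    u z ≤ u y + L * ‖z - y‖ := by
  refine le_of_forall_pos_le_add fun ε hε => ?_
  have := le_add_of_proxSubgrad_inner_lt (y := y) (e := z - y) (ρ := L * ‖z - y‖ + ε) hU hu
    (by simpa using hconv.segment_subset hy hz) fun ζ hζ ξ hξ => by
      have h1 := real_inner_le_norm ξ (z - y)
      have h2 := mul_le_mul_of_nonneg_right (h ζ hζ ξ hξ) (norm_nonneg (z - y))
      linarith
  rw [add_sub_cancel] at this
  linarith

/-- The slope of a smooth perturbation of a doubled quadratic penalty is controlled by the
directional growth of the function that it touches from above. -/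
theorem inner_le_of_touching_above [CompleteSpace Z] {V ψ : Z → ℝ} {ζ e g a : Z} {ρ k : ℝ}
    (hψ : HasGradientAt ψ g ζ)
    (hV : ∀ᶠ h in 𝓝[>] (0 : ℝ), V ζ ≤ V (ζ - h • e) + h * ρ)
    (htouch : ∀ᶠ ζ' in 𝓝 ζ, V ζ' - ψ ζ' - k * ‖a - ζ'‖ ^ 2 ≤ V ζ - ψ ζ - k * ‖a - ζ‖ ^ 2) :
    inner ℝ ((2 * k) • (ζ - a) + g) e ≤ ρ := by
  -- Inserting the growth bound of `V` into the touching inequality at `ζ - h • e` eliminates `V`: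
  -- `F` is smooth at `0` and `F 0 ≤ F h` for small `h > 0`, so its derivative there is nonnegative.
  set F : ℝ → ℝ := fun h => h * ρ + ψ (ζ - h • e) + k * ‖a - ζ + h • e‖ ^ 2 with hF
  have hline : HasDerivAt (fun h : ℝ => ζ - h • e) (-e) 0 := by
    simpa using ((hasDerivAt_id (0 : ℝ)).smul_const e).const_sub ζ
  have hψ' : HasDerivAt (fun h : ℝ => ψ (ζ - h • e)) (inner ℝ g (-e)) 0 := by
    have h1 : HasFDerivAt ψ (InnerProductSpace.toDual ℝ Z g) (ζ - (0 : ℝ) • e) := by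
      simpa using hψ.hasFDerivAt
    exact h1.comp_hasDerivAt 0 hline
  have hq : HasDerivAt (fun h : ℝ => ‖a - ζ + h • e‖ ^ 2) (2 * inner ℝ (a - ζ) e) 0 := by
    have h1 : HasDerivAt (fun h : ℝ => a - ζ + h • e) e 0 := by
      simpa using ((hasDerivAt_id (0 : ℝ)).smul_const e).const_add (a - ζ)
    simpa using h1.norm_sq
  have hder : HasDerivAt F (ρ + inner ℝ g (-e) + k * (2 * inner ℝ (a - ζ) e)) 0 := by
    refine HasDerivAt.add (HasDerivAt.add ?_ hψ') (hq.const_mul k)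
    simpa using (hasDerivAt_id (0 : ℝ)).mul_const ρ
  have hcont : Tendsto (fun h : ℝ => ζ - h • e) (𝓝[>] 0) (𝓝 ζ) := by
    have : Tendsto (fun h : ℝ => ζ - h • e) (𝓝 0) (𝓝 ζ) := by
      simpa using hline.continuousAt.tendsto
    exact this.mono_left nhdsWithin_le_nhds
  have hnn : ∀ᶠ h in 𝓝[>] (0 : ℝ), F 0 ≤ F h := by
    filter_upwards [hV, hcont.eventually htouch] with h h1 h2
    have h3 : a - (ζ - h • e) = a - ζ + h • e := by abel
    rw [h3] at h2
    simp only [hF, zero_mul, zero_smul, sub_zero, add_zero, zero_add]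
    linarith
  have hslope : 0 ≤ ρ + inner ℝ g (-e) + k * (2 * inner ℝ (a - ζ) e) := by
    have h1 := (hasDerivWithinAt_iff_tendsto_slope' (s := Ioi 0) (by simp)).1
      (hder.hasDerivWithinAt (s := Ioi 0))
    refine ge_of_tendsto h1 ?_
    filter_upwards [hnn, self_mem_nhdsWithin] with h h2 h3
    rw [slope_def_field]
    exact div_nonneg (by linarith) (by simpa using (mem_Ioi.1 h3).le)
  rw [inner_add_left, real_inner_smul_left]
  rw [inner_neg_right] at hslope
  have : inner ℝ (ζ - a) e = -inner ℝ (a - ζ) e := by rw [← inner_neg_left, neg_sub]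
  rw [this]
  linarith

/-- A lower semicontinuous supersolution `W` that touches from above a smooth perturbation of a
Lipschitz subsolution `V` shares a limiting slope with it. -/
theorem exists_common_slope [FiniteDimensional ℝ Z] [CompleteSpace Z] {V W ψ : Z → ℝ} {Dψ : Z → Z}
    {G : Z → Z → ℝ → ℝ} {z₀ : Z} {r L N : ℝ} (hr : 0 < r)
    (hV : LowerSemicontinuousOn V (ball z₀ r)) (hW : LowerSemicontinuousOn W (ball z₀ r))
    (hψ : ∀ z ∈ ball z₀ r, HasGradientAt ψ (Dψ z) z) (hDψ : ContinuousAt Dψ z₀)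
    (hG : ContinuousOn (fun q : Z × Z × ℝ => G q.1 q.2.1 q.2.2) (ball z₀ r ×ˢ univ))
    (hconv : ∀ s, ConvexOn ℝ univ fun ξ => G z₀ ξ s)
    (hsub : ∀ z ∈ ball z₀ r, ∀ ξ, IsProxSubgrad V z ξ → ‖ξ‖ ≤ L ∧ G z ξ (V z) ≤ 0)
    (hsup : ∀ z ∈ ball z₀ r, ∀ ξ, IsProxSubgrad W z ξ → W z < N → 0 ≤ G z ξ (W z))
    (hle : ∀ z ∈ ball z₀ r, V z - ψ z ≤ W z) (heq : V z₀ - ψ z₀ = W z₀) (hN : W z₀ < N) :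
    ∃ ξ, G z₀ (ξ + Dψ z₀) (V z₀) ≤ 0 ∧ 0 ≤ G z₀ ξ (W z₀) := by
  have hz₀ : z₀ ∈ ball z₀ r := mem_ball_self hr
  have hVL : ∀ y ∈ ball z₀ r, ∀ z ∈ ball z₀ r, V z ≤ V y + L * ‖z - y‖ := fun y hy z hz =>
    le_add_mul_norm_of_proxSubgrad_norm_le isOpen_ball (convex_ball _ _) hV
      (fun z hz ξ hξ => (hsub z hz ξ hξ).1) hy hz
  obtain ⟨D, r₁, hD, hr₁, hr₁r, hψL⟩ : ∃ D r₁, 0 ≤ D ∧ 0 < r₁ ∧ r₁ < r ∧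
      ∀ y ∈ closedBall z₀ r₁, ∀ z ∈ closedBall z₀ r₁, |ψ z - ψ y| ≤ D * ‖z - y‖ := by
    have h1 : ∀ᶠ z in 𝓝 z₀, ‖Dψ z‖ < ‖Dψ z₀‖ + 1 := hDψ.norm.eventually_lt_const (by linarith)
    obtain ⟨ε, hε, h2⟩ := Metric.eventually_nhds_iff_ball.1 h1
    refine ⟨‖Dψ z₀‖ + 1, min (ε / 2) (r / 2), by positivity, by positivity,
      by linarith [min_le_right (ε / 2) (r / 2)], fun y hy z hz => ?_⟩
    rw [← Real.norm_eq_abs]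
    refine (convex_closedBall z₀ _).norm_image_sub_le_of_norm_hasFDerivWithin_le
      (f' := fun z => InnerProductSpace.toDual ℝ Z (Dψ z)) (fun x hx => ?_) (fun x hx => ?_) hy hz
    · refine (hψ x (mem_ball.2 ((mem_closedBall.1 hx).trans_lt ?_))).hasFDerivAt.hasFDerivWithinAt
      linarith [min_le_right (ε / 2) (r / 2)]
    · simp only [LinearIsometryEquiv.norm_map]
      refine (h2 x (mem_ball.2 ((mem_closedBall.1 hx).trans_lt ?_))).le
      linarith [min_le_left (ε / 2) (r / 2)]
  set B := closedBall z₀ r₁ with hB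
  have hBr : B ⊆ ball z₀ r := closedBall_subset_ball hr₁r
  have hBc : IsCompact B := isCompact_closedBall _ _
  have hz₀B : z₀ ∈ B := mem_closedBall_self hr₁.le
  have hVcont : ContinuousOn V (ball z₀ r) := by
    have : LipschitzOnWith L.toNNReal V (ball z₀ r) := by
      refine LipschitzOnWith.of_le_add_mul _ fun y hy z hz => ?_
      have h1 := hVL z hz y hy
      have h2 : L * ‖y - z‖ ≤ L.toNNReal * ‖y - z‖ :=
        mul_le_mul_of_nonneg_right (Real.le_coe_toNNReal L) (norm_nonneg _)
      rw [dist_eq_norm]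
      linarith
    exact this.continuousOn
  have hψcont : ContinuousOn ψ (ball z₀ r) := fun z hz =>
    (hψ z hz).continuousAt.continuousWithinAt
  set L₁ := |L| + D with hL₁
  have hL₁0 : 0 ≤ L₁ := by positivity
  have hfL : ∀ y ∈ B, ∀ z ∈ B, (V z - ψ z) - (V y - ψ y) ≤ L₁ * ‖z - y‖ := by
    intro y hy z hz
    have h1 := hVL y (hBr hy) z (hBr hz)
    have h2 := neg_le_of_abs_le (hψL y hy z hz)
    have h3 : L * ‖z - y‖ ≤ |L| * ‖z - y‖ :=
      mul_le_mul_of_nonneg_right (le_abs_self L) (norm_nonneg _)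
    rw [hL₁, add_mul]
    linarith
  -- Doubling of variables. The touching at `z₀` need not be strict, and the term `‖z - z₀‖ ^ 2`
  -- forces the minimisers to converge to `z₀`.
  have hdouble : ∀ k : ℕ, ∃ q : Z × Z, q.1 ∈ B ∧ q.2 ∈ B ∧
      (∀ z ∈ B, ∀ ζ ∈ B, W q.1 - (V q.2 - ψ q.2) + (k + 1 : ℝ) * ‖q.1 - q.2‖ ^ 2 + ‖q.1 - z₀‖ ^ 2
        ≤ W z - (V ζ - ψ ζ) + (k + 1 : ℝ) * ‖z - ζ‖ ^ 2 + ‖z - z₀‖ ^ 2) := by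
    intro k
    have hF : LowerSemicontinuousOn (fun q : Z × Z => W q.1 + (-(V q.2 - ψ q.2) +
        ((k + 1 : ℝ) * ‖q.1 - q.2‖ ^ 2 + ‖q.1 - z₀‖ ^ 2))) (B ×ˢ B) := by
      refine LowerSemicontinuousOn.add ?_ (ContinuousOn.lowerSemicontinuousOn ?_)
      · exact (hW.mono hBr).comp continuous_fst.continuousOn fun q hq => hq.1
      · have h1 : ContinuousOn (fun q : Z × Z => V q.2 - ψ q.2) (B ×ˢ B) :=
          ((hVcont.sub hψcont).mono hBr).comp continuous_snd.continuousOn fun q hq => hq.2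
        exact h1.neg.add (by fun_prop)
    obtain ⟨q, hq, hmin⟩ := hF.exists_isMinOn
      (show (B ×ˢ B).Nonempty from ⟨(z₀, z₀), hz₀B, hz₀B⟩) (hBc.prod hBc)
    refine ⟨q, hq.1, hq.2, fun z hz ζ hζ => ?_⟩
    have : W q.1 + (-(V q.2 - ψ q.2) + ((k + 1 : ℝ) * ‖q.1 - q.2‖ ^ 2 + ‖q.1 - z₀‖ ^ 2)) ≤
      W z + (-(V ζ - ψ ζ) + ((k + 1 : ℝ) * ‖z - ζ‖ ^ 2 + ‖z - z₀‖ ^ 2)) :=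
      hmin (show (z, ζ) ∈ B ×ˢ B from ⟨hz, hζ⟩)
    linarith
  choose q hq1 hq2 hqmin using hdouble
  have hval : ∀ k : ℕ, W (q k).1 + (k + 1 : ℝ) * ‖(q k).1 - (q k).2‖ ^ 2 + ‖(q k).1 - z₀‖ ^ 2 ≤
      V (q k).2 - ψ (q k).2 := fun k => by
    have := hqmin k z₀ hz₀B z₀ hz₀B
    simp only [sub_self, norm_zero] at this
    linarith
  have hest : ∀ k : ℕ, (k + 1 : ℝ) * ‖(q k).1 - (q k).2‖ ^ 2 + ‖(q k).1 - z₀‖ ^ 2 ≤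
      L₁ * ‖(q k).1 - (q k).2‖ := fun k => by
    have h1 := hfL _ (hq1 k) _ (hq2 k)
    have h2 := hle _ (hBr (hq1 k))
    rw [norm_sub_rev] at h1
    linarith [hval k]
  have hk0 : ∀ k : ℕ, (0 : ℝ) < k + 1 := fun k => by positivity
  have hd : ∀ k : ℕ, (k + 1 : ℝ) * ‖(q k).1 - (q k).2‖ ≤ L₁ := fun k => by
    rcases (norm_nonneg ((q k).1 - (q k).2)).eq_or_lt with h | h
    · rw [← h, mul_zero]; exact hL₁0
    · refine le_of_mul_le_mul_right ?_ h
      nlinarith [hest k, sq_nonneg ‖(q k).1 - z₀‖]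
  have hd0 : Tendsto (fun k => ‖(q k).1 - (q k).2‖) atTop (𝓝 0) := by
    refine squeeze_zero (fun k => norm_nonneg _) (fun k => ?_)
      (tendsto_const_div_atTop_nhds_zero_nat L₁ |>.comp (tendsto_add_atTop_nat 1))
    simp only [Function.comp_apply, Nat.cast_add, Nat.cast_one]
    rw [le_div_iff₀ (hk0 k), mul_comm]
    exact hd k
  have hz0 : Tendsto (fun k => (q k).1) atTop (𝓝 z₀) := by
    rw [tendsto_iff_norm_sub_tendsto_zero]
    have h1 : Tendsto (fun k => ‖(q k).1 - z₀‖ ^ 2) atTop (𝓝 0) := by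
      refine squeeze_zero (fun k => by positivity) (fun k => ?_) (by simpa using hd0.const_mul L₁)
      have := hest k
      have h2 : 0 ≤ (k + 1 : ℝ) * ‖(q k).1 - (q k).2‖ ^ 2 := by positivity
      linarith
    have h2 := h1.sqrt
    simpa [Real.sqrt_sq] using h2
  have hζ0 : Tendsto (fun k => (q k).2) atTop (𝓝 z₀) := by
    have h1 : Tendsto (fun k => (q k).1 - (q k).2) atTop (𝓝 0) :=
      tendsto_zero_iff_norm_tendsto_zero.2 hd0
    simpa using hz0.sub h1
  have hVat : ContinuousAt V z₀ := hVcont.continuousAt (isOpen_ball.mem_nhds hz₀)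
  have hψat : ContinuousAt ψ z₀ := hψcont.continuousAt (isOpen_ball.mem_nhds hz₀)
  -- `W` is only lower semicontinuous, but along the minimisers it is squeezed between values of the
  -- continuous function `V - ψ`.
  have hW0 : Tendsto (fun k => W (q k).1) atTop (𝓝 (W z₀)) := by
    rw [← heq]
    refine tendsto_of_tendsto_of_tendsto_of_le_of_le ((hVat.sub hψat).tendsto.comp hz0)
      ((hVat.sub hψat).tendsto.comp hζ0) (fun k => hle _ (hBr (hq1 k))) fun k => ?_
    have h2 : 0 ≤ (k + 1 : ℝ) * ‖(q k).1 - (q k).2‖ ^ 2 := by positivity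
    have h3 : 0 ≤ ‖(q k).1 - z₀‖ ^ 2 := by positivity
    change W (q k).1 ≤ V (q k).2 - ψ (q k).2
    linarith [hval k]
  set ξ : ℕ → Z := fun k => (2 * (k + 1 : ℝ)) • ((q k).2 - (q k).1) with hξ
  have hξb : ∀ k, ‖ξ k‖ ≤ 2 * L₁ := fun k => by
    rw [hξ]
    simp only [norm_smul, Real.norm_eq_abs]
    rw [abs_of_pos (by linarith [hk0 k]), norm_sub_rev]
    linarith [hd k]
  obtain ⟨ξ₀, -, s, hs, hξlim⟩ := tendsto_subseq_of_bounded (isBounded_closedBall (x := (0 : Z))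
    (r := 2 * L₁)) (fun k => mem_closedBall_zero_iff.2 (hξb k))
  have hst := hs.tendsto_atTop
  have hGat : ∀ ξ' r', ContinuousAt (fun q : Z × Z × ℝ => G q.1 q.2.1 q.2.2) (z₀, ξ', r') :=
    fun ξ' r' => hG.continuousAt (prod_mem_nhds (isOpen_ball.mem_nhds hz₀) univ_mem)
  refine ⟨ξ₀, ?_, ?_⟩
  -- Minimality in the second variable touches `V` from above and gives no subgradient. The set `C`
  -- below is convex because `G` is, and contains the proximal subgradients of `V` near `z₀`;
  -- separating the limit slope from it gives the direction `e` to which the mean value inequality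
  -- applies.
  · by_contra! hpos
    set η := G z₀ (ξ₀ + Dψ z₀) (V z₀) / 2 with hη
    have hη0 : 0 < η := by positivity
    have hGc : Continuous fun ξ' => G z₀ ξ' (V z₀) := continuous_iff_continuousAt.2 fun ξ' =>
      ContinuousAt.comp (f := fun ξ' : Z => (z₀, ξ', V z₀)) (hGat ξ' (V z₀)) (by fun_prop)
    set C : Set Z := closedBall 0 L ∩ {ξ' | G z₀ ξ' (V z₀) ≤ η} with hC
    have hCc : Convex ℝ C := (convex_closedBall _ _).inter (by
      simpa using (hconv (V z₀)).convex_le η)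
    have hCcl : IsClosed C := isClosed_closedBall.inter (isClosed_le hGc continuous_const)
    have hnot : ξ₀ + Dψ z₀ ∉ C := fun h => by
      have : G z₀ (ξ₀ + Dψ z₀) (V z₀) ≤ η := h.2
      linarith
    obtain ⟨f, ρ, hf1, hf2⟩ := geometric_hahn_banach_closed_point hCc hCcl hnot
    set e := (InnerProductSpace.toDual ℝ Z).symm f with he
    have hfe : ∀ x, f x = inner ℝ x e := fun x => by
      rw [real_inner_comm, he, InnerProductSpace.toDual_symm_apply]
    have hnear : ∀ᶠ z in 𝓝 z₀, ∀ ξ' ∈ closedBall (0 : Z) L, G z₀ ξ' (V z₀) - G z ξ' (V z) < η := by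
      refine (isCompact_closedBall (0 : Z) L).eventually_forall_of_forall_eventually fun ξ' _ => ?_
      have h1 : ContinuousAt (fun p : Z × Z => G z₀ p.2 (V z₀) - G p.1 p.2 (V p.1)) (z₀, ξ') := by
        refine ContinuousAt.sub ?_ ?_
        · exact hGc.continuousAt.comp continuousAt_snd
        · refine ContinuousAt.comp_of_eq (f := fun p : Z × Z => (p.1, p.2, V p.1))
            (hGat ξ' (V z₀)) ?_ rfl
          refine continuousAt_fst.prodMk (continuousAt_snd.prodMk ?_)
          exact ContinuousAt.comp_of_eq hVat continuousAt_fst rfl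
      exact h1.eventually_lt_const (by simpa using hη0)
    obtain ⟨r₂, hr₂, hr₂'⟩ := Metric.eventually_nhds_iff_ball.1
      (hnear.and (isOpen_ball.mem_nhds hz₀))
    have hCin : ∀ z ∈ ball z₀ r₂, ∀ ξ', IsProxSubgrad V z ξ' → inner ℝ ξ' e < ρ := by
      intro z hz ξ' hξ'
      obtain ⟨h1, h2⟩ := hsub z (hr₂' z hz).2 ξ' hξ'
      have h3 := (hr₂' z hz).1 ξ' (by simpa using h1)
      rw [← hfe]
      exact hf1 _ ⟨by simpa using h1, by change G z₀ ξ' (V z₀) ≤ η; linarith⟩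
    have hgrow : ∀ ζ ∈ ball z₀ r₂, ∀ᶠ h in 𝓝[>] (0 : ℝ), V ζ ≤ V (ζ - h • e) + h * ρ := by
      intro ζ hζ
      have h1 : Tendsto (fun h : ℝ => ζ - h • e) (𝓝[>] 0) (𝓝 ζ) := by
        have : Tendsto (fun h : ℝ => ζ - h • e) (𝓝 0) (𝓝 (ζ - (0 : ℝ) • e)) :=
          Continuous.tendsto (by fun_prop) _
        rw [zero_smul, sub_zero] at this
        exact this.mono_left nhdsWithin_le_nhds
      filter_upwards [h1.eventually (isOpen_ball.mem_nhds hζ), self_mem_nhdsWithin] with h h2 h3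
      have h3 : 0 < h := h3
      have h4 := le_add_of_proxSubgrad_inner_lt (u := V) (y := ζ - h • e) (e := h • e)
        (ρ := h * ρ) isOpen_ball (hV.mono fun z hz => (hr₂' z hz).2)
        (by simpa using (convex_ball z₀ r₂).segment_subset h2 hζ) fun z hz ξ' hξ' => by
          rw [real_inner_smul_right]
          exact mul_lt_mul_of_pos_left (hCin z hz ξ' hξ') h3
      rwa [sub_add_cancel] at h4
    have hineq : ∀ᶠ k in atTop, inner ℝ (ξ k + Dψ (q k).2) e ≤ ρ := by
      filter_upwards [hζ0.eventually (isOpen_ball.mem_nhds (mem_ball_self hr₂)),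
        hζ0.eventually (isOpen_ball.mem_nhds (mem_ball_self hr₁))] with k h1 h2
      refine inner_le_of_touching_above (V := V) (ψ := ψ) (k := k + 1) (a := (q k).1)
        (hψ _ (hBr (hq2 k))) (hgrow _ h1) ?_
      filter_upwards [isOpen_ball.mem_nhds h2] with ζ' hζ'
      have := hqmin k _ (hq1 k) ζ' (ball_subset_closedBall hζ')
      linarith
    have hlim : Tendsto (fun k => inner ℝ (ξ (s k) + Dψ (q (s k)).2) e) atTop
        (𝓝 (inner ℝ (ξ₀ + Dψ z₀) e)) :=
      (hξlim.add (hDψ.tendsto.comp (hζ0.comp hst))).inner tendsto_const_nhds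
    have := le_of_tendsto hlim (hst.eventually hineq)
    rw [← hfe] at this
    linarith
  -- Minimality in the first variable gives a genuine proximal subgradient of `W`; the correction
  -- from the localising term vanishes in the limit.
  · have hineq : ∀ᶠ k in atTop, 0 ≤ G (q k).1 (ξ k - (2 : ℝ) • ((q k).1 - z₀)) (W (q k).1) := by
      filter_upwards [hz0.eventually (isOpen_ball.mem_nhds (mem_ball_self hr₁)),
        hW0.eventually_lt_const hN] with k h1 h2
      refine hsup _ (hBr (hq1 k)) _ ⟨(k + 1 : ℝ) + 1, ?_⟩ h2
      filter_upwards [isOpen_ball.mem_nhds h1] with z' hz'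
      have h3 := hqmin k z' (ball_subset_closedBall hz') _ (hq2 k)
      have h4 := norm_sq_sub_norm_sq ((q k).1 - (q k).2) (z' - (q k).2)
      have h5 := norm_sq_sub_norm_sq ((q k).1 - z₀) (z' - z₀)
      rw [sub_sub_sub_cancel_right] at h4 h5
      have h6 : inner ℝ (ξ k - (2 : ℝ) • ((q k).1 - z₀)) (z' - (q k).1) =
          -(2 * (k + 1 : ℝ)) * inner ℝ ((q k).1 - (q k).2) (z' - (q k).1) -
            2 * inner ℝ ((q k).1 - z₀) (z' - (q k).1) := by
        rw [inner_sub_left, hξ]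
        simp only [real_inner_smul_left]
        rw [← neg_sub (q k).1 (q k).2, inner_neg_left]
        ring
      rw [h6]
      nlinarith
    have hlim : Tendsto (fun k => G (q (s k)).1 (ξ (s k) - (2 : ℝ) • ((q (s k)).1 - z₀))
        (W (q (s k)).1)) atTop (𝓝 (G z₀ ξ₀ (W z₀))) := by
      have h1 : Tendsto (fun k => ξ (s k) - (2 : ℝ) • ((q (s k)).1 - z₀)) atTop (𝓝 ξ₀) := by
        have : Tendsto (fun k => (2 : ℝ) • ((q (s k)).1 - z₀)) atTop (𝓝 0) := by
          simpa using ((hz0.comp hst).sub_const z₀).const_smul (2 : ℝ)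
        simpa using hξlim.sub this
      exact (hGat ξ₀ (W z₀)).tendsto.comp
        ((hz0.comp hst).prodMk_nhds (h1.prodMk_nhds (hW0.comp hst)))
    exact ge_of_tendsto hlim (hst.eventually hineq)

end ProximalCalculus

/-! ### The Hamiltonian in chart coordinates. -/

section ChartHamiltonian

variable {n : ℕ} {M : Type*} [TopologicalSpace M] [ChartedSpace (EuclideanSpace ℝ (Fin n)) M]
  [IsManifold (𝓡 n) ∞ M]

/-- The covector at `x` with coordinates `p` in the chart around `x₀`. -/
noncomputable def chartCovector (x₀ x : M) (p : EuclideanSpace ℝ (Fin n)) :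
    CotSpace n M x :=
  ContinuousLinearMap.comp (innerSL ℝ p : EuclideanSpace ℝ (Fin n) →L[ℝ] ℝ)
    ((trivializationAt (EuclideanSpace ℝ (Fin n)) (TangentSpace (𝓡 n)) x₀).continuousLinearMapAt ℝ x)

/-- The expression of a Hamiltonian in the chart around `x₀`. -/
noncomputable def chartHam (H : (x : M) → CotSpace n M x → ℝ → ℝ) (x₀ : M)
    (y p : EuclideanSpace ℝ (Fin n)) (r : ℝ) : ℝ :=
  H ((extChartAt (𝓡 n) x₀).symm y) (chartCovector x₀ _ p) r

theorem chartCovector_comp_symmL {x₀ x : M}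
    (hx : x ∈ (chartAt (EuclideanSpace ℝ (Fin n)) x₀).source) (p : EuclideanSpace ℝ (Fin n)) :
    (chartCovector x₀ x p).comp
      ((trivializationAt (EuclideanSpace ℝ (Fin n)) (TangentSpace (𝓡 n)) x₀).symmL ℝ x) =
      (innerSL ℝ p : EuclideanSpace ℝ (Fin n) →L[ℝ] ℝ) := by
  ext v
  have hx' : x ∈ (trivializationAt (EuclideanSpace ℝ (Fin n))
    (TangentSpace (𝓡 n)) x₀).baseSet := by simpa using hx
  change innerSL ℝ p (((trivializationAt (EuclideanSpace ℝ (Fin n))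
    (TangentSpace (𝓡 n)) x₀).continuousLinearMapAt ℝ x) ((trivializationAt (EuclideanSpace ℝ (Fin n))
    (TangentSpace (𝓡 n)) x₀).symmL ℝ x v)) = _
  rw [Trivialization.continuousLinearMapAt_symmL _ hx']

theorem trivializationAt_chartCovector {x₀ x : M}
    (hx : x ∈ (chartAt (EuclideanSpace ℝ (Fin n)) x₀).source) (p : EuclideanSpace ℝ (Fin n)) :
    trivializationAt (EuclideanSpace ℝ (Fin n) →L[ℝ] ℝ) (CotSpace n M) x₀ ⟨x, chartCovector x₀ x p⟩
      = (x, innerSL ℝ p) := by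
  rw [hom_trivializationAt_apply]
  refine Prod.ext rfl ?_
  simp only [ContinuousLinearMap.inCoordinates]
  rw [chartCovector_comp_symmL hx]
  ext v
  simp

/-- In coordinates, passing from `(y, p)` to a covector is the inverse of the local trivialisation
of the cotangent bundle, hence continuous. -/
theorem continuousOn_chartHam {H : (x : M) → CotSpace n M x → ℝ → ℝ} (hH : HamContinuous H)
    (x₀ : M) :
    ContinuousOn (fun q : EuclideanSpace ℝ (Fin n) × EuclideanSpace ℝ (Fin n) × ℝ =>
      chartHam H x₀ q.1 q.2.1 q.2.2) ((extChartAt (𝓡 n) x₀).target ×ˢ univ) := by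
  set e := trivializationAt (EuclideanSpace ℝ (Fin n) →L[ℝ] ℝ) (CotSpace n M) x₀ with he
  have hsrc : ∀ y ∈ (extChartAt (𝓡 n) x₀).target, (extChartAt (𝓡 n) x₀).symm y ∈
      (chartAt (EuclideanSpace ℝ (Fin n)) x₀).source := fun y hy => by
    simpa using (extChartAt (𝓡 n) x₀).map_target hy
  have hmap : ContinuousOn (fun q : EuclideanSpace ℝ (Fin n) × EuclideanSpace ℝ (Fin n) × ℝ =>
      ((⟨(extChartAt (𝓡 n) x₀).symm q.1, chartCovector x₀ _ q.2.1⟩ : CotBundle n M), q.2.2))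
      ((extChartAt (𝓡 n) x₀).target ×ˢ univ) := by
    refine ContinuousOn.prodMk ?_ (by fun_prop)
    have h1 : ContinuousOn (fun q : EuclideanSpace ℝ (Fin n) × EuclideanSpace ℝ (Fin n) × ℝ =>
        e.toOpenPartialHomeomorph.symm ((extChartAt (𝓡 n) x₀).symm q.1,
          (innerSL ℝ q.2.1 : EuclideanSpace ℝ (Fin n) →L[ℝ] ℝ)))
        ((extChartAt (𝓡 n) x₀).target ×ˢ univ) := by
      refine e.toOpenPartialHomeomorph.continuousOn_symm.comp ?_ ?_
      · refine ContinuousOn.prodMk ((continuousOn_extChartAt_symm x₀).comp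
          continuous_fst.continuousOn fun q hq => hq.1) ?_
        exact ((innerSL ℝ (E := EuclideanSpace ℝ (Fin n))).continuous.comp
          (continuous_fst.comp continuous_snd)).continuousOn
      · rintro q ⟨hq, -⟩
        rw [he]
        have := hsrc _ hq
        change _ ∈ (trivializationAt (EuclideanSpace ℝ (Fin n) →L[ℝ] ℝ) (CotSpace n M) x₀).target
        rw [hom_trivializationAt_target]
        exact ⟨⟨by simpa using this, mem_univ _⟩, mem_univ _⟩
    refine h1.congr ?_
    rintro q ⟨hq, -⟩
    have h2 := trivializationAt_chartCovector (hsrc _ hq) q.2.1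
    rw [← he] at h2
    have h3 : (⟨(extChartAt (𝓡 n) x₀).symm q.1, chartCovector x₀ _ q.2.1⟩ : CotBundle n M) ∈
        e.source := by
      rw [he, hom_trivializationAt_source]
      exact ⟨by simpa using hsrc _ hq, mem_univ _⟩
    have h4 := e.toOpenPartialHomeomorph.left_inv h3
    change _ = e.toOpenPartialHomeomorph.symm _
    rw [← h2]
    exact h4.symm
  exact (Continuous.comp_continuousOn hH hmap :)

theorem chartCovector_add_smul (x₀ x : M) (p q : EuclideanSpace ℝ (Fin n)) (a b : ℝ) :
    chartCovector x₀ x (a • p + b • q) = a • chartCovector x₀ x p + b • chartCovector x₀ x q := by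
  ext v
  change inner ℝ (a • p + b • q) _ = a * inner ℝ p _ + b * inner ℝ q _
  rw [inner_add_left, real_inner_smul_left, real_inner_smul_left]

theorem convexOn_chartHam {H : (x : M) → CotSpace n M x → ℝ → ℝ} (hH : HamConvex H)
    (x₀ : M) (y : EuclideanSpace ℝ (Fin n)) (r : ℝ) :
    ConvexOn ℝ univ fun p => chartHam H x₀ y p r := by
  refine ⟨convex_univ, fun p _ q _ a b ha hb hab => ?_⟩
  simp only [chartHam, chartCovector_add_smul]
  exact (hH _ r).2 (mem_univ _) (mem_univ _) ha hb hab

end ChartHamiltonian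

/-! ### Coercivity in charts. -/

section Coercive

variable {n : ℕ} {M : Type*} [TopologicalSpace M] [ChartedSpace (EuclideanSpace ℝ (Fin n)) M]
  [IsManifold (𝓡 n) ∞ M] [RiemannianBundle (fun x : M => TangentSpace (𝓡 n) x)]
  [h : IsContMDiffRiemannianBundle (𝓡 n) ∞ (EuclideanSpace ℝ (Fin n))
      (fun x : M => TangentSpace (𝓡 n) x)]

/-- The coordinates are recovered by composing the covector with the inverse trivialisation, whose
operator norm is locally bounded for a continuous metric. This transfers coercivity from the
Riemannian norm to coordinates. -/
theorem eventually_norm_le_norm_chartCovector (x₀ : M) :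
    ∃ C > 0, ∀ᶠ x in 𝓝 x₀, ∀ p : EuclideanSpace ℝ (Fin n),
      ‖p‖ ≤ C * ‖chartCovector (n := n) x₀ x p‖ := by
  have : IsContinuousRiemannianBundle (EuclideanSpace ℝ (Fin n))
      (fun x : M => TangentSpace (𝓡 n) x) := by
    obtain ⟨g, hg, hg'⟩ := h.exists_contMDiff
    exact ⟨g, hg.continuous, hg'⟩
  obtain ⟨C, hC, hev⟩ := eventually_norm_symmL_trivializationAt_lt (EuclideanSpace ℝ (Fin n))
    (fun x : M => TangentSpace (𝓡 n) x) x₀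
  refine ⟨C, hC, ?_⟩
  filter_upwards [hev, chart_source_mem_nhds (EuclideanSpace ℝ (Fin n)) x₀] with x h1 h2 p
  rw [← innerSL_apply_norm ℝ p, ← chartCovector_comp_symmL h2 p]
  refine (ContinuousLinearMap.opNorm_comp_le _ _).trans ?_
  rw [mul_comm]
  exact mul_le_mul_of_nonneg_right h1.le (norm_nonneg _)

/-- Near the centre of a chart, the chart expression of a coercive Hamiltonian is bounded below and
its sublevel sets in the momentum variable are uniformly bounded. -/
theorem exists_chartHam_bounds {H : (x : M) → CotSpace n M x → ℝ → ℝ} (hH1 : HamContinuous H)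
    (hH2 : HamCoercive H) (x₀ : M) (R B : ℝ) :
    ∃ ρ > 0, ∃ K C : ℝ, Metric.ball (extChartAt (𝓡 n) x₀ x₀) ρ ⊆ (extChartAt (𝓡 n) x₀).target ∧
      ∀ y ∈ Metric.ball (extChartAt (𝓡 n) x₀ x₀) ρ, ∀ p r, |r| ≤ R →
        -C ≤ chartHam H x₀ y p r ∧ (chartHam H x₀ y p r ≤ B → ‖p‖ ≤ K) := by
  obtain ⟨c, hc, hev⟩ := eventually_norm_le_norm_chartCovector (n := n) x₀
  -- One coercivity constant must bound both the range of `u` and the level of `H`; the `1` only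
  -- ensures positivity.
  obtain ⟨K₁, hK₁, hcoer⟩ := hH2 (max (max R |B|) 1) (by positivity)
  have hcont : ContinuousAt (extChartAt (𝓡 n) x₀).symm (extChartAt (𝓡 n) x₀ x₀) :=
    continuousAt_extChartAt_symm x₀
  have hev' : ∀ᶠ y in 𝓝 (extChartAt (𝓡 n) x₀ x₀), ∀ p : EuclideanSpace ℝ (Fin n),
      ‖p‖ ≤ c * ‖chartCovector (n := n) x₀ ((extChartAt (𝓡 n) x₀).symm y) p‖ := by
    exact hcont.tendsto.eventually (p := fun x => ∀ p : EuclideanSpace ℝ (Fin n),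
      ‖p‖ ≤ c * ‖chartCovector (n := n) x₀ x p‖) (by rwa [extChartAt_to_inv])
  obtain ⟨ρ, hρ, hball⟩ := Metric.eventually_nhds_iff_ball.1
    (hev'.and (extChartAt_target_mem_nhds (I := 𝓡 n) x₀))
  have hK : ∀ y ∈ Metric.ball (extChartAt (𝓡 n) x₀ x₀) ρ, ∀ p r, |r| ≤ R →
      chartHam H x₀ y p r ≤ |B| → ‖p‖ ≤ c * K₁ := by
    intro y hy p r hr hp
    refine ((hball y hy).1 p).trans (mul_le_mul_of_nonneg_left ?_ hc.le)
    by_contra! hlt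
    have h1 := hcoer _ (chartCovector (n := n) x₀ ((extChartAt (𝓡 n) x₀).symm y) p) r
      (hr.trans ((le_max_left _ _).trans (le_max_left _ _))) hlt.le
    have h2 : |B| ≤ max (max R |B|) 1 := (le_max_right _ _).trans (le_max_left _ _)
    exact absurd hp (not_le.2 (h2.trans_lt h1))
  have hcomp : IsCompact (Metric.closedBall (extChartAt (𝓡 n) x₀ x₀) (ρ / 2) ×ˢ
      Metric.closedBall (0 : EuclideanSpace ℝ (Fin n)) (c * K₁) ×ˢ Icc (-R) R) :=
    (isCompact_closedBall _ _).prod ((isCompact_closedBall _ _).prod isCompact_Icc)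
  obtain ⟨C, hC⟩ := (hcomp.image_of_continuousOn ((continuousOn_chartHam hH1 x₀).mono
    fun q hq => ⟨(hball _ (Metric.closedBall_subset_ball (by linarith) hq.1)).2,
      mem_univ _⟩)).bddBelow
  refine ⟨ρ / 2, by positivity, c * K₁, |C|, fun y hy =>
    (hball y (Metric.ball_subset_ball (by linarith) hy)).2, fun y hy p r hr => ⟨?_, fun hp =>
      hK y (Metric.ball_subset_ball (by linarith) hy) p r hr (hp.trans (le_abs_self B))⟩⟩
  -- Below level `|B|` the momentum lies in a compact set, where `H` is bounded; above it, `H` is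
  -- positive or zero.
  by_cases hp : chartHam H x₀ y p r ≤ |B|
  · refine (neg_abs_le C).trans (hC ⟨(y, p, r), ⟨Metric.ball_subset_closedBall hy, ?_, ?_⟩, rfl⟩)
    · simpa using hK y (Metric.ball_subset_ball (by linarith) hy) p r hr hp
    · exact abs_le.1 hr
  · have := abs_nonneg B
    have := abs_nonneg C
    linarith

end Coercive

/-! ### Global test functions from local lower bounds. -/

section TestFunctions

/-- An exhaustion of the time interval, blowing up at both ends. It is needed because test functions
must give a minimum over all of `M × (0, T)`, while `u` may tend to `-∞` at the ends. -/
theorem exists_proper_contDiffOn (T : EReal) : ∃ d : ℝ → ℝ,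
    ContDiffOn ℝ 1 d {s | 0 < s ∧ (s : EReal) < T} ∧
      ∀ R, ∃ K, IsCompact K ∧ K ⊆ {s : ℝ | 0 < s ∧ (s : EReal) < T} ∧
        ∀ s : ℝ, 0 < s → (s : EReal) < T → d s ≤ R → s ∈ K := by
  have hinv : ContDiffOn ℝ 1 (fun s : ℝ => s⁻¹) (Ioi 0) :=
    contDiffOn_inv ℝ |>.mono fun s hs => (ne_of_gt hs : s ≠ 0)
  induction T with
  | bot => exact ⟨fun _ => 0, contDiffOn_const, fun R => ⟨∅, by simp⟩⟩
  | top =>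
    refine ⟨fun s => s⁻¹ + s, ?_, fun R => ⟨Icc (|R| + 1)⁻¹ (|R| + 1), isCompact_Icc, ?_, ?_⟩⟩
    · exact (hinv.mono fun s hs => hs.1).add contDiffOn_id
    · intro s hs
      exact ⟨lt_of_lt_of_le (by positivity) hs.1, EReal.coe_lt_top s⟩
    · intro s hs _ hd
      have h1 : 0 < s⁻¹ := inv_pos.2 hs
      have h2 := le_abs_self R
      refine ⟨?_, by linarith⟩
      exact inv_le_of_inv_le₀ hs (by linarith)
  | coe a =>
    refine ⟨fun s => s⁻¹ + (a - s)⁻¹, ?_, fun R =>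
      ⟨Icc (|R| + 1)⁻¹ (a - (|R| + 1)⁻¹), isCompact_Icc, ?_, ?_⟩⟩
    · refine (hinv.mono fun s hs => hs.1).add
        (hinv.comp (contDiffOn_const.sub contDiffOn_id) fun s hs => ?_)
      have : s < a := EReal.coe_lt_coe_iff.1 hs.2
      simpa using this
    · intro s hs
      have : 0 < (|R| + 1)⁻¹ := by positivity
      exact ⟨lt_of_lt_of_le this hs.1, EReal.coe_lt_coe_iff.2 (by linarith [hs.2])⟩
    · intro s hs hsa hd
      have hsa' : 0 < a - s := by linarith [EReal.coe_lt_coe_iff.1 hsa]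
      have h1 : 0 < s⁻¹ := inv_pos.2 hs
      have h2 : 0 < (a - s)⁻¹ := inv_pos.2 hsa'
      have h3 := le_abs_self R
      refine ⟨inv_le_of_inv_le₀ hs (by linarith), ?_⟩
      have := inv_le_of_inv_le₀ hsa' (b := |R| + 1) (by linarith)
      linarith

theorem exists_coe_le_of_isCompact {X : Type*} [TopologicalSpace X] {u : X → EReal} {S : Set X}
    (hu : IsLSC u S) {K : Set X} (hK : IsCompact K) (hKS : K ⊆ S) :
    ∃ c : ℝ, ∀ z ∈ K, (c : EReal) ≤ u z := by
  rcases K.eq_empty_or_nonempty with rfl | hne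
  · exact ⟨0, by simp⟩
  · obtain ⟨z₀, hz₀, hmin⟩ := (hu.1.mono hKS).exists_isMinOn hne hK
    obtain ⟨c, hc⟩ := EReal.lt_iff_exists_real_btwn.1 (bot_lt_iff_ne_bot.2 (hu.2 z₀ (hKS hz₀)))
    exact ⟨c, fun z hz => hc.2.le.trans (hmin hz)⟩

/-- A lower semicontinuous function on `M × (0, T)`, `M` compact, is bounded below by a `C¹`
function of time. -/
theorem exists_contDiffOn_neg_le {M : Type*} [TopologicalSpace M] [CompactSpace M] {T : EReal}
    {u : M × ℝ → EReal} (hu : IsLSC u (openCyl M T)) : ∃ g : ℝ → ℝ,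
      ContDiffOn ℝ 1 g {s | 0 < s ∧ (s : EReal) < T} ∧
        ∀ z ∈ openCyl M T, ((-g z.2 : ℝ) : EReal) ≤ u z := by
  obtain ⟨d, hd, hdK⟩ := exists_proper_contDiffOn T
  have hloc : ∀ R : ℝ, ∃ c : ℝ, ∀ z ∈ openCyl M T, d z.2 ≤ R → ((-c : ℝ) : EReal) ≤ u z := by
    intro R
    obtain ⟨K, hKc, hKs, hK⟩ := hdK R
    obtain ⟨c, hc⟩ := exists_coe_le_of_isCompact hu (isCompact_univ.prod hKc)
      (fun z hz => hKs hz.2)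
    exact ⟨-c, fun z hz hzR => by
      rw [neg_neg]; exact hc z ⟨mem_univ _, hK _ hz.1 hz.2 hzR⟩⟩
  -- Partition of unity: the constants admissible at level `R` form a convex set, and a constant for
  -- level `R + 1` serves all levels near `R`.
  obtain ⟨G, hG⟩ := exists_contMDiffMap_forall_mem_convex_of_local_const (M := ℝ) (n := 1) 𝓘(ℝ, ℝ)
    (t := fun R => {c : ℝ | ∀ z ∈ openCyl M T, d z.2 ≤ R → ((-c : ℝ) : EReal) ≤ u z})
    (fun R => by
      refine OrdConnected.convex ⟨fun a ha b _ c hc z hz hzR => ?_⟩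
      exact le_trans (EReal.coe_le_coe_iff.2 (by linarith [hc.1])) (ha z hz hzR))
    (fun R => by
      obtain ⟨c, hc⟩ := hloc (R + 1)
      refine ⟨c, ?_⟩
      filter_upwards [eventually_lt_nhds (show R < R + 1 by linarith)] with R' hR' z hz hzR
      exact hc z hz (by linarith))
  refine ⟨fun s => G (d s), ?_, fun z hz => hG (d z.2) z hz le_rfl⟩
  exact G.contMDiff.contDiff.comp_contDiffOn hd

/-- Space-time coordinates, with the Euclidean norm. -/
abbrev ChartSpaceTime (n : ℕ) : Type := WithLp 2 (EuclideanSpace ℝ (Fin n) × ℝ)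

variable {n : ℕ} {M : Type*} [TopologicalSpace M] [ChartedSpace (EuclideanSpace ℝ (Fin n)) M]

/-- The point of `M × ℝ` with given coordinates in the chart around `x₀`. -/
noncomputable def chartPoint (x₀ : M) (z : ChartSpaceTime n) : M × ℝ :=
  ((extChartAt (𝓡 n) x₀).symm z.fst, z.snd)

theorem spaceTime_inner_eq (z w : ChartSpaceTime n) :
    inner ℝ z w = inner ℝ z.fst w.fst + z.snd * w.snd := by
  rw [WithLp.prod_inner_apply]
  change _ + w.snd * z.snd = _
  rw [mul_comm]
  rfl

theorem spaceTime_norm_sq_eq (z : ChartSpaceTime n) : ‖z‖ ^ 2 = ‖z.fst‖ ^ 2 + z.snd ^ 2 := by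
  rw [WithLp.prod_norm_sq_eq_of_L2, Real.norm_eq_abs, sq_abs]

theorem contMDiffAt_comp_chart [IsManifold (𝓡 n) ∞ M] {P : EuclideanSpace ℝ (Fin n) × ℝ → ℝ}
    (hP : ContDiff ℝ 1 P) {x₀ : M} {q : M × ℝ} (hq : q.1 ∈ (extChartAt (𝓡 n) x₀).source) :
    ContMDiffAt ((𝓡 n).prod 𝓘(ℝ, ℝ)) 𝓘(ℝ, ℝ) 1 (fun q => P (extChartAt (𝓡 n) x₀ q.1, q.2)) q := by
  have he : ContMDiffAt ((𝓡 n).prod 𝓘(ℝ, ℝ)) 𝓘(ℝ, EuclideanSpace ℝ (Fin n)) 1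
      (fun q : M × ℝ => extChartAt (𝓡 n) x₀ q.1) q :=
    (contMDiffAt_extChartAt' (by rwa [extChartAt_source] at hq)).comp q contMDiffAt_fst
  exact hP.contMDiff.contMDiffAt.comp q (he.prodMk_space contMDiffAt_snd)

theorem timeDeriv_of_eventuallyEq {P : EuclideanSpace ℝ (Fin n) × ℝ → ℝ} {x₀ x : M} {t τ : ℝ}
    {p : EuclideanSpace ℝ (Fin n)}
    (hP : HasFDerivAt P ((innerSL ℝ p).coprod (τ • ContinuousLinearMap.id ℝ ℝ))
      (extChartAt (𝓡 n) x₀ x, t)) {φ : M × ℝ → ℝ}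
    (hφ : ∀ᶠ q in 𝓝 (x, t), φ q = P (extChartAt (𝓡 n) x₀ q.1, q.2)) :
    timeDeriv φ x t = τ := by
  have h1 : ∀ᶠ s in 𝓝 t, φ (x, s) = P (extChartAt (𝓡 n) x₀ x, s) :=
    (Continuous.prodMk_right x).continuousAt.eventually hφ
  have h2 : HasDerivAt (fun s => P (extChartAt (𝓡 n) x₀ x, s)) τ t := by
    have h3 := hP.comp_hasDerivAt t ((hasDerivAt_const t (extChartAt (𝓡 n) x₀ x)).prodMk
      (hasDerivAt_id t))
    exact HasDerivAt.congr_deriv h3 (by simp)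
  exact (h2.congr_of_eventuallyEq h1).deriv

theorem spaceDiff_of_eventuallyEq [IsManifold (𝓡 n) ∞ M]
    {P : EuclideanSpace ℝ (Fin n) × ℝ → ℝ} {x₀ x : M} {t τ : ℝ}
    {p : EuclideanSpace ℝ (Fin n)} (hx : x ∈ (extChartAt (𝓡 n) x₀).source)
    (hP : HasFDerivAt P ((innerSL ℝ p).coprod (τ • ContinuousLinearMap.id ℝ ℝ))
      (extChartAt (𝓡 n) x₀ x, t)) {φ : M × ℝ → ℝ}
    (hφ : ∀ᶠ q in 𝓝 (x, t), φ q = P (extChartAt (𝓡 n) x₀ q.1, q.2)) :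
    spaceDiff n φ x t = chartCovector x₀ x p := by
  rw [extChartAt_source] at hx
  have h1 : ∀ᶠ x' in 𝓝 x, φ (x', t) = P (extChartAt (𝓡 n) x₀ x', t) :=
    (Continuous.prodMk_left t).continuousAt.eventually hφ
  have h2 : HasFDerivAt (fun y => P (y, t)) (innerSL ℝ p) (extChartAt (𝓡 n) x₀ x) := by
    have h3 := hP.comp (extChartAt (𝓡 n) x₀ x) ((hasFDerivAt_id (𝕜 := ℝ) _).prodMk
      (hasFDerivAt_const t _))
    exact HasFDerivAt.congr_fderiv h3 (by ext v; simp)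
  have h4 : HasMFDerivAt (𝓡 n) 𝓘(ℝ, EuclideanSpace ℝ (Fin n)) (extChartAt (𝓡 n) x₀) x
      (mfderiv (𝓡 n) 𝓘(ℝ, EuclideanSpace ℝ (Fin n)) (extChartAt (𝓡 n) x₀) x) :=
    (mdifferentiableAt_extChartAt hx).hasMFDerivAt
  have h5 := (h2.hasMFDerivAt.comp x h4).congr_of_eventuallyEq (f₁ := fun x' => φ (x', t)) h1
  have h6 := h5.mfderiv
  rw [spaceDiff, h6, chartCovector, TangentBundle.continuousLinearMapAt_trivializationAt hx]
  rfl

/-- A second order local lower bound in a chart is realised by a global test function. -/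
theorem exists_isTestFun [IsManifold (𝓡 n) ∞ M] [T2Space M] [CompactSpace M] {T : EReal}
    {u : M × ℝ → EReal} (hu : IsLSC u (openCyl M T))
    {x₀ : M} {z ξ : ChartSpaceTime n} {r σ : ℝ} (hz : z.fst ∈ (extChartAt (𝓡 n) x₀).target)
    (hr : u (chartPoint x₀ z) = r)
    (hprox : ∀ᶠ z' in 𝓝 z, ((r + inner ℝ ξ (z' - z) - σ * ‖z' - z‖ ^ 2 : ℝ) : EReal) ≤
      u (chartPoint x₀ z')) :
    ∃ φ : M × ℝ → ℝ, IsTestFun n T φ ∧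
      IsMinOn (fun z => u z - (φ z : EReal)) (openCyl M T) (chartPoint x₀ z) ∧
      timeDeriv φ (chartPoint x₀ z).1 z.snd = ξ.snd ∧
      spaceDiff n φ (chartPoint x₀ z).1 z.snd = chartCovector x₀ _ ξ.fst := by
  obtain ⟨g, hg, hgu⟩ := exists_contDiffOn_neg_le hu
  set x := (extChartAt (𝓡 n) x₀).symm z.fst with hx
  have hxsrc : x ∈ (extChartAt (𝓡 n) x₀).source := (extChartAt (𝓡 n) x₀).map_target hz
  have hex : extChartAt (𝓡 n) x₀ x = z.fst := (extChartAt (𝓡 n) x₀).right_inv hz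
  obtain ⟨P, hP⟩ : ∃ P : EuclideanSpace ℝ (Fin n) × ℝ → ℝ, ∀ p, P p = inner ℝ ξ.fst (p.1 - z.fst) +
    ξ.snd * (p.2 - z.snd) - σ * (‖p.1 - z.fst‖ ^ 2 + (p.2 - z.snd) ^ 2) := ⟨_, fun _ => rfl⟩
  have hP' := funext hP
  have hPs : ContDiff ℝ 1 P := by
    rw [hP']
    have h1 : ContDiff ℝ 1 fun p : EuclideanSpace ℝ (Fin n) × ℝ => ‖p.1 - z.fst‖ ^ 2 :=
      ContDiff.norm_sq ℝ (by fun_prop)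
    have h2 : ContDiff ℝ 1 fun p : EuclideanSpace ℝ (Fin n) × ℝ =>
        inner ℝ ξ.fst (p.1 - z.fst) := ContDiff.inner ℝ contDiff_const (by fun_prop)
    fun_prop
  have hPd : HasFDerivAt P ((innerSL ℝ ξ.fst).coprod (ξ.snd • ContinuousLinearMap.id ℝ ℝ))
      (extChartAt (𝓡 n) x₀ x, z.snd) := by
    rw [hP', hex]
    have h1 : HasFDerivAt (fun p : EuclideanSpace ℝ (Fin n) × ℝ => p.1 - z.fst)
      (ContinuousLinearMap.fst ℝ _ _) (z.fst, z.snd) := hasFDerivAt_fst.sub_const _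
    have h2 : HasFDerivAt (fun p : EuclideanSpace ℝ (Fin n) × ℝ => p.2 - z.snd)
      (ContinuousLinearMap.snd ℝ _ _) (z.fst, z.snd) := hasFDerivAt_snd.sub_const _
    have h3 := (((innerSL ℝ ξ.fst).hasFDerivAt.comp _ h1).add (h2.const_mul ξ.snd)).sub
      ((h1.norm_sq.add (h2.pow 2)).const_mul σ)
    exact HasFDerivAt.congr_fderiv h3 (by ext v <;> simp)
  have hsrc : (extChartAt (𝓡 n) x₀).source ×ˢ (univ : Set ℝ) ∈ 𝓝 (x, z.snd) :=
    prod_mem_nhds ((isOpen_extChartAt_source x₀).mem_nhds hxsrc) univ_mem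
  have hQu : ∀ᶠ q in 𝓝 (x, z.snd),
      ((r + P (extChartAt (𝓡 n) x₀ q.1, q.2) : ℝ) : EReal) ≤ u q := by
    have hc : Tendsto (fun q : M × ℝ => (WithLp.toLp 2 (extChartAt (𝓡 n) x₀ q.1, q.2) :
        ChartSpaceTime n)) (𝓝 (x, z.snd)) (𝓝 z) := by
      have h1 : ContinuousAt (fun q : M × ℝ => (extChartAt (𝓡 n) x₀ q.1, q.2)) (x, z.snd) :=
        ((continuousAt_extChartAt' hxsrc).comp_of_eq continuousAt_fst rfl).prodMk continuousAt_snd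
      have h2 := (WithLp.prod_continuous_toLp 2 _ _).continuousAt.comp h1
      have h3 : (WithLp.toLp 2 (extChartAt (𝓡 n) x₀ x, z.snd) : ChartSpaceTime n) = z := by
        rw [hex]
        rfl
      unfold ContinuousAt at h2
      simpa only [Function.comp_def, h3] using h2
    filter_upwards [hc.eventually hprox, hsrc] with q h1 h2
    have h3 : chartPoint x₀ (WithLp.toLp 2 (extChartAt (𝓡 n) x₀ q.1, q.2) : ChartSpaceTime n) = q :=
      Prod.ext ((extChartAt (𝓡 n) x₀).left_inv h2.1) rfl
    rw [h3, spaceTime_norm_sq_eq, spaceTime_inner_eq] at h1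
    convert h1 using 2
    rw [hP]
    simp only [WithLp.sub_fst, WithLp.sub_snd, WithLp.toLp_fst, WithLp.toLp_snd]
    ring
  obtain ⟨χ, -, hχ⟩ := (SmoothBumpFunction.nhds_basis_tsupport (I := (𝓡 n).prod 𝓘(ℝ, ℝ))
    (x, z.snd)).mem_iff.1 (inter_mem hQu hsrc)
  -- Chosen so that `r + φ` is the convex combination, with weight `χ`, of the local lower bound `r
  -- + P` and the global lower bound `-g` of `u`.
  obtain ⟨φ, hφ⟩ : ∃ φ : M × ℝ → ℝ, ∀ q, φ q = χ q * P (extChartAt (𝓡 n) x₀ q.1, q.2) -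
    (1 - χ q) * (g q.2 + r) := ⟨_, fun _ => rfl⟩
  have hφP : ∀ᶠ q in 𝓝 (x, z.snd), φ q = P (extChartAt (𝓡 n) x₀ q.1, q.2) := by
    filter_upwards [χ.eventuallyEq_one] with q hq
    rw [hφ, hq, Pi.one_apply]
    ring
  refine ⟨φ, ?_, ?_, timeDeriv_of_eventuallyEq hPd hφP, spaceDiff_of_eventuallyEq hxsrc hPd hφP⟩
  · have h1 : ContMDiff ((𝓡 n).prod 𝓘(ℝ, ℝ)) 𝓘(ℝ, ℝ) 1
        fun q => χ q * P (extChartAt (𝓡 n) x₀ q.1, q.2) := by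
      refine contMDiff_of_tsupport fun q hq => ?_
      have hq' : q.1 ∈ (extChartAt (𝓡 n) x₀).source :=
        (hχ (tsupport_mul_subset_left hq)).2.1
      exact (χ.contMDiffAt.of_le (by exact_mod_cast le_top)).mul (contMDiffAt_comp_chart hPs hq')
    have h2 : ContMDiffOn ((𝓡 n).prod 𝓘(ℝ, ℝ)) 𝓘(ℝ, ℝ) 1 (fun q : M × ℝ => g q.2) (openCyl M T) :=
      hg.contMDiffOn.comp contMDiffOn_snd fun q hq => hq
    have h3 : ContMDiff ((𝓡 n).prod 𝓘(ℝ, ℝ)) 𝓘(ℝ, ℝ) 1 χ :=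
      χ.contMDiff.of_le (by exact_mod_cast le_top)
    rw [IsTestFun, funext hφ]
    exact h1.contMDiffOn.sub ((contMDiffOn_const.sub h3.contMDiffOn).mul
      (h2.add contMDiffOn_const))
  · intro q hq
    have hφ0 : φ (x, z.snd) = 0 := by
      rw [hφP.self_of_nhds, hP, hex]
      simp
    change u (x, z.snd) - (φ (x, z.snd) : EReal) ≤ u q - (φ q : EReal)
    have hr' : u (x, z.snd) = r := hr
    rw [hφ0, hr', EReal.coe_zero, sub_zero, EReal.le_sub_iff_add_le (by simp) (by simp),
      ← EReal.coe_add]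
    have hgq := hgu q hq
    have h0 : 0 ≤ χ q := χ.nonneg
    have h1 : χ q ≤ 1 := χ.le_one
    have h2 : r + φ q = χ q * (r + P (extChartAt (𝓡 n) x₀ q.1, q.2)) + (1 - χ q) * -g q.2 := by
      rw [hφ]; ring
    by_cases hχq : χ q = 0
    · rw [h2, hχq]
      simpa using hgq
    · have hPq : ((r + P (extChartAt (𝓡 n) x₀ q.1, q.2) : ℝ) : EReal) ≤ u q :=
        (hχ (subset_tsupport _ (Function.mem_support.2 hχq))).1
      refine le_trans (EReal.coe_le_coe_iff.2 ?_) (max_le hPq hgq)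
      rw [h2]
      set a := r + P (extChartAt (𝓡 n) x₀ q.1, q.2)
      have h3 := mul_le_mul_of_nonneg_left (le_max_left a (-g q.2)) h0
      have h4 := mul_le_mul_of_nonneg_left (le_max_right a (-g q.2)) (sub_nonneg.2 h1)
      linarith

end TestFunctions

/-- Along the line, `g` minus the supporting parabola has a local minimum at `0`, so its derivative
vanishes. Thus contact from above by a differentiable function fixes the slope. -/
theorem IsProxSubgrad.inner_eq {Z : Type*} [NormedAddCommGroup Z] [InnerProductSpace ℝ Z]
    {u : Z → ℝ} {z ξ w : Z} (h : IsProxSubgrad u z ξ) {g : ℝ → ℝ} {d : ℝ} (hg : HasDerivAt g d 0)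
    (hg0 : g 0 = u z) (hle : ∀ᶠ s in 𝓝 (0 : ℝ), u (z + s • w) ≤ g s) : inner ℝ ξ w = d := by
  obtain ⟨σ, hσ⟩ := h
  have hline : Tendsto (fun s : ℝ => z + s • w) (𝓝 0) (𝓝 z) := by
    have : Tendsto (fun s : ℝ => z + s • w) (𝓝 0) (𝓝 (z + (0 : ℝ) • w)) :=
      Continuous.tendsto (by fun_prop) _
    simpa using this
  have hmin : IsLocalMin (fun s : ℝ => g s - s * inner ℝ ξ w + σ * ‖w‖ ^ 2 * s ^ 2) 0 := by
    filter_upwards [hle, hline.eventually hσ] with s h1 h2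
    rw [add_sub_cancel_left, real_inner_smul_right, norm_smul, mul_pow, Real.norm_eq_abs,
      sq_abs] at h2
    rw [hg0]
    linarith
  have hder : HasDerivAt (fun s : ℝ => g s - s * inner ℝ ξ w + σ * ‖w‖ ^ 2 * s ^ 2)
      (d - 1 * inner ℝ ξ w + σ * ‖w‖ ^ 2 * (2 * 0)) 0 := by
    refine (hg.sub ((hasDerivAt_id (0 : ℝ)).mul_const _)).add (HasDerivAt.const_mul _ ?_)
    simpa using hasDerivAt_pow 2 (0 : ℝ)
  have := hmin.hasDerivAt_eq_zero hder
  linarith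

theorem exists_forall_of_forall_eventually {X : Type*} [TopologicalSpace X] [CompactSpace X]
    {P : ℝ → X → Prop} (hmono : ∀ C C' x, C ≤ C' → P C x → P C' x)
    (h : ∀ x₀, ∃ C, ∀ᶠ x in 𝓝 x₀, P C x) : ∃ C, ∀ x, P C x := by
  have := isCompact_univ.induction_on (X := X) (p := fun S => ∃ C, ∀ x ∈ S, P C x)
    ⟨0, by simp⟩ (fun S S' hS ⟨C, hC⟩ => ⟨C, fun x hx => hC x (hS hx)⟩)
    (fun S S' ⟨C, hC⟩ ⟨C', hC'⟩ => ⟨max C C', fun x hx => hx.elim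
      (fun hx => hmono _ _ _ (le_max_left _ _) (hC x hx))
      (fun hx => hmono _ _ _ (le_max_right _ _) (hC' x hx))⟩)
    (fun x _ => by
      obtain ⟨C, hC⟩ := h x
      exact ⟨_, mem_nhdsWithin_of_mem_nhds hC, C, fun x hx => hx⟩)
  obtain ⟨C, hC⟩ := this
  exact ⟨C, fun x => hC x (mem_univ x)⟩

/-! ### Proximal solutions and truncation. -/

section ProximalSolutions

variable {n : ℕ} {M : Type*} [TopologicalSpace M] [ChartedSpace (EuclideanSpace ℝ (Fin n)) M]

theorem continuous_spaceTime_fst : Continuous fun z : ChartSpaceTime n => z.fst :=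
  continuous_fst.comp (WithLp.prod_continuous_ofLp 2 _ _)

theorem continuous_spaceTime_snd : Continuous fun z : ChartSpaceTime n => z.snd :=
  continuous_snd.comp (WithLp.prod_continuous_ofLp 2 _ _)

theorem continuousAt_chartPoint {x₀ : M} {z : ChartSpaceTime n}
    (hz : z.fst ∈ (extChartAt (𝓡 n) x₀).target) : ContinuousAt (chartPoint x₀) z :=
  ((continuousAt_extChartAt_symm'' hz).comp_of_eq continuous_spaceTime_fst.continuousAt rfl).prodMk
    continuous_spaceTime_snd.continuousAt

theorem isOpen_spaceTime {S : Set (EuclideanSpace ℝ (Fin n))} (hS : IsOpen S) {I : Set ℝ}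
    (hI : IsOpen I) : IsOpen {z : ChartSpaceTime n | z.fst ∈ S ∧ z.snd ∈ I} :=
  (hS.preimage continuous_spaceTime_fst).inter (hI.preimage continuous_spaceTime_snd)

theorem lowerSemicontinuousOn_comp_chartPoint {f : M × ℝ → ℝ} (hf : LowerSemicontinuous f) (x₀ : M)
    {S : Set (ChartSpaceTime n)} (hS : ∀ z ∈ S, z.fst ∈ (extChartAt (𝓡 n) x₀).target) :
    LowerSemicontinuousOn (fun z => f (chartPoint x₀ z)) S := fun z hz y hy =>
  ((continuousAt_chartPoint (hS z hz)).eventually (hf _ y hy)).filter_mono nhdsWithin_le_nhds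

section Truncation

open Classical in
/-- Truncation of `u` from above by `ψ`, extended by a constant outside of `[0, T']`. -/
noncomputable def truncation {X : Type*} (u : X × ℝ → EReal) (ψ : ℝ → ℝ) (T' R : ℝ)
    (z : X × ℝ) : ℝ :=
  if z.2 ∈ Icc 0 T' then (min (u z) (ψ z.2)).toReal else R

variable {u : M × ℝ → EReal} {ψ : ℝ → ℝ} {T' R : ℝ}

theorem coe_truncation {X : Type*} {u : X × ℝ → EReal}
    (hu : ∀ z : X × ℝ, z.2 ∈ Icc 0 T' → u z ≠ ⊥) {z : X × ℝ}
    (hz : z.2 ∈ Icc 0 T') : ((truncation u ψ T' R z : ℝ) : EReal) = min (u z) (ψ z.2) := by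
  rw [truncation, if_pos hz, EReal.coe_toReal]
  · exact ((min_le_right _ _).trans_lt (EReal.coe_lt_top _)).ne
  · exact (lt_min (bot_lt_iff_ne_bot.2 (hu z hz)) (EReal.bot_lt_coe _)).ne'

theorem truncation_le {X : Type*} {u : X × ℝ → EReal}
    (hu : ∀ z : X × ℝ, z.2 ∈ Icc 0 T' → u z ≠ ⊥) (hR : ∀ t ∈ Icc 0 T', ψ t ≤ R) (z : X × ℝ) :
    truncation u ψ T' R z ≤ R := by
  by_cases hz : z.2 ∈ Icc 0 T'
  · rw [← EReal.coe_le_coe_iff, coe_truncation hu hz]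
    exact (min_le_right _ _).trans (EReal.coe_le_coe_iff.2 (hR _ hz))
  · rw [truncation, if_neg hz]

/-- The constant outside the closed slab is an upper bound for the truncation, so crossing the
boundary of the slab outwards can only jump up. -/
theorem lowerSemicontinuous_truncation (hu : IsLSC u {z : M × ℝ | z.2 ∈ Icc 0 T'})
    (hψ : Continuous ψ) (hR : ∀ t ∈ Icc 0 T', ψ t ≤ R) :
    LowerSemicontinuous (truncation u ψ T' R) := by
  intro z y hy
  by_cases hz : z.2 ∈ Icc 0 T'
  · have h1 : (y : EReal) < min (u z) (ψ z.2) := by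
      rw [← coe_truncation (R := R) hu.2 hz]
      exact EReal.coe_lt_coe_iff.2 hy
    have h2 := hu.1 z hz y (h1.trans_le (min_le_left _ _))
    have h3 : ∀ᶠ z' : M × ℝ in 𝓝 z, y < ψ z'.2 := by
      refine (hψ.comp continuous_snd).continuousAt.eventually_const_lt ?_
      exact EReal.coe_lt_coe_iff.1 (h1.trans_le (min_le_right _ _))
    filter_upwards [eventually_nhdsWithin_iff.1 h2, h3] with z' h4 h5
    by_cases hz' : z'.2 ∈ Icc 0 T'
    · change y < _
      rw [← EReal.coe_lt_coe_iff, coe_truncation hu.2 hz']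
      exact lt_min (h4 hz') (EReal.coe_lt_coe_iff.2 h5)
    · change y < _
      rw [truncation, if_neg hz']
      exact hy.trans_le (truncation_le hu.2 hR z)
  · have h1 : ∀ᶠ z' : M × ℝ in 𝓝 z, z'.2 ∉ Icc 0 T' :=
      (isClosed_Icc.preimage continuous_snd).isOpen_compl.mem_nhds hz
    filter_upwards [h1] with z' hz'
    change y < _
    rw [truncation, if_neg hz']
    rwa [truncation, if_neg hz] at hy

theorem exists_le_truncation [CompactSpace M] (hu : IsLSC u {z : M × ℝ | z.2 ∈ Icc 0 T'})
    (hψ : Continuous ψ) : ∃ c, ∀ z, c ≤ truncation u ψ T' R z := by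
  obtain ⟨c, hc⟩ := exists_coe_le_of_isCompact hu (isCompact_univ.prod (isCompact_Icc (a := 0)
    (b := T'))) (fun z hz => hz.2)
  obtain ⟨c', hc'⟩ := (isCompact_Icc (a := 0) (b := T')).bddBelow_image hψ.continuousOn
  refine ⟨min (min c c') R, fun z => ?_⟩
  by_cases hz : z.2 ∈ Icc 0 T'
  · rw [← EReal.coe_le_coe_iff, coe_truncation hu.2 hz]
    refine le_min (le_trans (EReal.coe_le_coe_iff.2 ?_) (hc z ⟨mem_univ _, hz⟩))
      (EReal.coe_le_coe_iff.2 ?_)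
    · exact (min_le_left _ _).trans (min_le_left _ _)
    · exact ((min_le_left _ _).trans (min_le_right _ _)).trans (hc' ⟨_, hz, rfl⟩)
  · rw [truncation, if_neg hz]
    exact min_le_right _ _

theorem eventually_chartPoint_snd_mem {x₀ : M} {z : ChartSpaceTime n} (hz : z.snd ∈ Ioo 0 T') :
    ∀ᶠ z' in 𝓝 z, (chartPoint x₀ z').2 ∈ Icc 0 T' :=
  (continuous_spaceTime_snd.continuousAt.eventually (isOpen_Ioo.mem_nhds hz)).mono
    fun _ h => Ioo_subset_Icc_self h

theorem eventually_le_of_prox_truncation (hu : ∀ z : M × ℝ, z.2 ∈ Icc 0 T' → u z ≠ ⊥) {x₀ : M}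
    {z ξ : ChartSpaceTime n} (hzI : z.snd ∈ Ioo 0 T') {σ : ℝ}
    (hσ : ∀ᶠ z' in 𝓝 z, truncation u ψ T' R (chartPoint x₀ z) + inner ℝ ξ (z' - z) -
      σ * ‖z' - z‖ ^ 2 ≤ truncation u ψ T' R (chartPoint x₀ z')) :
    ∀ᶠ z' in 𝓝 z, ((truncation u ψ T' R (chartPoint x₀ z) + inner ℝ ξ (z' - z) -
      σ * ‖z' - z‖ ^ 2 : ℝ) : EReal) ≤ u (chartPoint x₀ z') := by
  filter_upwards [hσ, eventually_chartPoint_snd_mem (x₀ := x₀) hzI] with z' h1 h2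
  refine (EReal.coe_le_coe_iff.2 h1).trans ?_
  rw [coe_truncation hu h2]
  exact min_le_left _ _

variable [IsManifold (𝓡 n) ∞ M]

/-- `f` is a subsolution at times in `I`, in the sense of proximal subgradients in charts. -/
def IsProxSubsolution (H : (x : M) → CotSpace n M x → ℝ → ℝ) (I : Set ℝ) (f : M × ℝ → ℝ) : Prop :=
  ∀ (x₀ : M) (z ξ : ChartSpaceTime n), z.fst ∈ (extChartAt (𝓡 n) x₀).target → z.snd ∈ I →
    IsProxSubgrad (fun z => f (chartPoint x₀ z)) z ξ →
      ξ.snd + chartHam H x₀ z.fst ξ.fst (f (chartPoint x₀ z)) ≤ 0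

/-- `f` is a supersolution at times in `I` and at points where `f < N`, in the sense of proximal
subgradients in charts. -/
def IsProxSupersolution (H : (x : M) → CotSpace n M x → ℝ → ℝ) (I : Set ℝ) (N : ℝ)
    (f : M × ℝ → ℝ) : Prop :=
  ∀ (x₀ : M) (z ξ : ChartSpaceTime n), z.fst ∈ (extChartAt (𝓡 n) x₀).target → z.snd ∈ I →
    IsProxSubgrad (fun z => f (chartPoint x₀ z)) z ξ → f (chartPoint x₀ z) < N →
      0 ≤ ξ.snd + chartHam H x₀ z.fst ξ.fst (f (chartPoint x₀ z))

variable [T2Space M] [CompactSpace M] {H : (x : M) → CotSpace n M x → ℝ → ℝ} {T : EReal}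

/-- Below the level `N` the truncation equals `u`, and it lies under `u` nearby, so its proximal
lower bounds there are lower bounds for `u` and produce test functions. -/
theorem IsBJSupersolution.isProxSupersolution_truncation (h : IsBJSupersolution H T u)
    (hT : (T' : EReal) < T) (hu : ∀ z : M × ℝ, z.2 ∈ Icc 0 T' → u z ≠ ⊥) {N : ℝ} :
    IsProxSupersolution H (Ioo 0 T') N (truncation u (fun _ => N) T' N) := by
  rintro x₀ z ξ hz hzI ⟨σ, hσ⟩ hN
  have hcoe := coe_truncation (R := N) (ψ := fun _ => N) hu (z := chartPoint x₀ z)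
    (Ioo_subset_Icc_self hzI)
  have hr : u (chartPoint x₀ z) = (truncation u (fun _ => N) T' N (chartPoint x₀ z) : ℝ) := by
    rw [hcoe, eq_comm, min_eq_left_iff]
    by_contra! hlt
    rw [min_eq_right hlt.le, EReal.coe_eq_coe_iff] at hcoe
    exact hN.ne hcoe
  have hzT : chartPoint x₀ z ∈ openCyl M T :=
    ⟨hzI.1, (EReal.coe_lt_coe_iff.2 hzI.2).trans hT⟩
  obtain ⟨φ, hφ, hmin, ht, hs⟩ := exists_isTestFun h.1 hz hr
    (eventually_le_of_prox_truncation hu hzI hσ)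
  have := h.2 φ hφ _ _ hzT hmin _ hr
  change 0 ≤ timeDeriv φ (chartPoint x₀ z).1 z.snd + H _ (spaceDiff n φ (chartPoint x₀ z).1 z.snd) _
    at this
  rwa [ht, hs] at this

/-- With tests from below, a minimum of two subsolutions is a subsolution: where `u ≤ ψ`, lower
bounds for the minimum touch `u`; where `ψ < u`, contact with the differentiable `ψ` forces the
subgradient to be the gradient of `ψ`, whose space part is zero. -/
theorem IsBJSubsolution.isProxSubsolution_truncation (h : IsBJSubsolution H T u)
    (hT : (T' : EReal) < T) (hu : ∀ z : M × ℝ, z.2 ∈ Icc 0 T' → u z ≠ ⊥) {ψ' : ℝ → ℝ}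
    (hψ : ∀ t, HasDerivAt ψ (ψ' t) t) (hψH : ∀ t ∈ Icc 0 T', ∀ x, ψ' t + H x 0 (ψ t) ≤ 0) :
    IsProxSubsolution H (Ioo 0 T') (truncation u ψ T' R) := by
  rintro x₀ z ξ hz hzI hprox
  have hcoe := coe_truncation (R := R) (ψ := ψ) hu (z := chartPoint x₀ z)
    (Ioo_subset_Icc_self hzI)
  rcases le_or_gt (u (chartPoint x₀ z)) (ψ (chartPoint x₀ z).2) with hle | hlt
  · obtain ⟨σ, hσ⟩ := hprox
    have hr : u (chartPoint x₀ z) = (truncation u ψ T' R (chartPoint x₀ z) : ℝ) := by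
      rw [hcoe, min_eq_left hle]
    have hzT : chartPoint x₀ z ∈ openCyl M T :=
      ⟨hzI.1, (EReal.coe_lt_coe_iff.2 hzI.2).trans hT⟩
    obtain ⟨φ, hφ, hmin, ht, hs⟩ := exists_isTestFun h.1 hz hr
      (eventually_le_of_prox_truncation hu hzI hσ)
    have := h.2 φ hφ _ _ hzT hmin _ hr
    change timeDeriv φ (chartPoint x₀ z).1 z.snd +
      H _ (spaceDiff n φ (chartPoint x₀ z).1 z.snd) _ ≤ 0 at this
    rwa [ht, hs] at this
  · have hval : truncation u ψ T' R (chartPoint x₀ z) = ψ z.snd := by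
      rw [min_eq_right hlt.le, EReal.coe_eq_coe_iff] at hcoe
      exact hcoe
    have hin : ∀ w : ChartSpaceTime n, inner ℝ ξ w = ψ' z.snd * w.snd := by
      intro w
      refine hprox.inner_eq (g := fun s => ψ (z.snd + s * w.snd)) ?_ ?_ ?_
      · have h1 : HasDerivAt ψ (ψ' z.snd) (z.snd + 0 * w.snd) := by simpa using hψ z.snd
        have h2 : HasDerivAt (fun s : ℝ => z.snd + s * w.snd) w.snd 0 := by
          simpa using ((hasDerivAt_id (0 : ℝ)).mul_const w.snd).const_add z.snd
        exact h1.comp 0 h2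
      · simp [hval]
      · have hline : Tendsto (fun s : ℝ => z + s • w) (𝓝 0) (𝓝 z) := by
          have : Tendsto (fun s : ℝ => z + s • w) (𝓝 0) (𝓝 (z + (0 : ℝ) • w)) :=
            Continuous.tendsto (by fun_prop) _
          simpa using this
        filter_upwards [hline.eventually (eventually_chartPoint_snd_mem (x₀ := x₀) hzI)] with s hs
        rw [← EReal.coe_le_coe_iff, coe_truncation hu hs]
        exact min_le_right _ _
    have hfst : ξ.fst = 0 := by
      have := hin (WithLp.toLp 2 (ξ.fst, 0))
      rw [spaceTime_inner_eq] at this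
      simpa using this
    have hsnd : ξ.snd = ψ' z.snd := by
      have := hin (WithLp.toLp 2 (0, 1))
      rw [spaceTime_inner_eq] at this
      simpa using this
    have hcov : ∀ x : M, chartCovector x₀ x (0 : EuclideanSpace ℝ (Fin n)) = 0 := fun x => by
      simpa using chartCovector_add_smul x₀ x (0 : EuclideanSpace ℝ (Fin n)) 0 0 0
    rw [hval, hfst, hsnd, chartHam, hcov]
    exact hψH _ (Ioo_subset_Icc_self hzI) _

end Truncation

end ProximalSolutions

/-! ### Growth and regularisation in time. -/

section TimeRegularity

variable {n : ℕ} {M : Type*} [TopologicalSpace M] [ChartedSpace (EuclideanSpace ℝ (Fin n)) M]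
  [IsManifold (𝓡 n) ∞ M]

theorem exists_forall_zero_le [CompactSpace M] {H : (x : M) → CotSpace n M x → ℝ → ℝ}
    (hH1 : HamContinuous H) : ∃ C, ∀ x, H x 0 0 ≤ C := by
  have h1 : Continuous fun x : M => H x 0 0 := by
    have h2 : Continuous fun x : M => ((⟨x, 0⟩ : CotBundle n M), (0 : ℝ)) :=
      (Trivialization.continuous_zeroSection ℝ).prodMk continuous_const
    exact (hH1 : Continuous _).comp h2
  obtain ⟨C, hC⟩ := (isCompact_range h1).bddAbove
  exact ⟨C, fun x => hC ⟨x, rfl⟩⟩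

/-- Bounded subsolutions grow at most linearly in time. -/
theorem IsProxSubsolution.exists_le_add_mul [CompactSpace M]
    [RiemannianBundle (fun x : M => TangentSpace (𝓡 n) x)]
    [IsContMDiffRiemannianBundle (𝓡 n) ∞ (EuclideanSpace ℝ (Fin n))
      (fun x : M => TangentSpace (𝓡 n) x)]
    {H : (x : M) → CotSpace n M x → ℝ → ℝ} (hH1 : HamContinuous H) (hH2 : HamCoercive H)
    {f : M × ℝ → ℝ} (hf : LowerSemicontinuous f) {R : ℝ} (hR : ∀ z, |f z| ≤ R) {a b : ℝ}
    (hsub : IsProxSubsolution H (Ioo a b) f) :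
    ∃ C, ∀ x t s, a < t → t ≤ s → s < b → f (x, s) ≤ f (x, t) + C * (s - t) := by
  refine exists_forall_of_forall_eventually (fun C C' x hC h t s ht hts hs => ?_) fun x₀ => ?_
  · have := mul_le_mul_of_nonneg_right hC (sub_nonneg.2 hts)
    linarith [h t s ht hts hs]
  · obtain ⟨ρ, hρ, _K, C, hball, hC⟩ := exists_chartHam_bounds hH1 hH2 x₀ R 0
    refine ⟨C, ?_⟩
    filter_upwards [(continuousAt_extChartAt (I := 𝓡 n) x₀).eventually (Metric.ball_mem_nhds _ hρ),
      extChartAt_source_mem_nhds (I := 𝓡 n) x₀] with x hx hxs t s ht hts hs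
    refine le_of_forall_pos_le_add fun ε hε => ?_
    set y : ChartSpaceTime n := WithLp.toLp 2 (extChartAt (𝓡 n) x₀ x, t) with hy
    set e : ChartSpaceTime n := WithLp.toLp 2 (0, s - t) with he
    have hye : y + e = WithLp.toLp 2 (extChartAt (𝓡 n) x₀ x, s) := by
      rw [hy, he, ← WithLp.toLp_add]
      simp
    have hp : ∀ r : ℝ, chartPoint x₀ (WithLp.toLp 2 (extChartAt (𝓡 n) x₀ x, r) :
        ChartSpaceTime n) = (x, r) := fun r =>
      Prod.ext ((extChartAt (𝓡 n) x₀).left_inv hxs) rfl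
    have hU : IsOpen {z : ChartSpaceTime n |
        z.fst ∈ Metric.ball (extChartAt (𝓡 n) x₀ x₀) ρ ∧ z.snd ∈ Ioo a b} :=
      isOpen_spaceTime Metric.isOpen_ball isOpen_Ioo
    -- Mean value inequality in a pure time direction: the lower bound `-C` on the Hamiltonian
    -- bounds the time slopes above by `C`.
    have hmain := le_add_of_proxSubgrad_inner_lt (u := fun z => f (chartPoint x₀ z)) (y := y)
      (e := e) (ρ := C * (s - t) + ε) hU
      (lowerSemicontinuousOn_comp_chartPoint hf x₀ fun z hz => hball hz.1) (by
        rw [segment_eq_image']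
        rintro _ ⟨θ, hθ, rfl⟩
        have h1 : 0 ≤ θ * (s - t) := mul_nonneg hθ.1 (sub_nonneg.2 hts)
        have h2 : θ * (s - t) ≤ s - t := mul_le_of_le_one_left (sub_nonneg.2 hts) hθ.2
        rw [add_sub_cancel_left]
        refine ⟨?_, ?_, ?_⟩
        · simpa [hy, he] using hx
        · change a < t + θ * (s - t)
          linarith
        · change t + θ * (s - t) < b
          linarith) fun z hz ξ hξ => by
        have h1 := hsub x₀ z ξ (hball hz.1) hz.2 hξ
        have h2 := (hC z.fst hz.1 ξ.fst _ (hR (chartPoint x₀ z))).1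
        have h3 : inner ℝ ξ e = ξ.snd * (s - t) := by
          rw [spaceTime_inner_eq]
          simp [he]
        rw [h3]
        have h4 : ξ.snd * (s - t) ≤ C * (s - t) :=
          mul_le_mul_of_nonneg_right (by linarith) (sub_nonneg.2 hts)
        linarith
    rw [hye] at hmain
    simp only [hy, hp] at hmain
    linarith

theorem exp_neg_sub_bound {x : ℝ} (hx : |x| ≤ 1) : Real.exp (-x) ≤ 1 - x + x ^ 2 := by
  have := (abs_le.1 (Real.abs_exp_sub_one_sub_id_le (x := -x) (by rwa [abs_neg]))).2
  linarith [neg_sq x]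

/-- Time regularisation of a bounded subsolution by an exponentially weighted inf-convolution. -/
theorem IsProxSubsolution.exists_regularization {H : (x : M) → CotSpace n M x → ℝ → ℝ} {Λ : ℝ}
    (hΛ : 0 < Λ) (hH4 : ∀ (x : M) (p : CotSpace n M x) (u v : ℝ), |H x p u - H x p v| ≤ Λ * |u - v|)
    {f : M × ℝ → ℝ} (hf : LowerSemicontinuous f) {R : ℝ} (hR0 : 0 ≤ R)
    (hR : ∀ z, |f z| ≤ R) {T' δ : ℝ} (hT' : 0 < T') (hδ : 0 < δ) (hsub : IsProxSubsolution H (Ioo 0 T') f) :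
    ∃ (V : M × ℝ → ℝ) (B : ℝ), LowerSemicontinuous V ∧
      IsProxSubsolution H (Ioo (-δ) (T' - 3 * δ)) V ∧
      (∀ (x₀ : M) (z ξ : ChartSpaceTime n), z.snd ∈ Ioo (-δ) (T' - 3 * δ) →
        IsProxSubgrad (fun z => V (chartPoint x₀ z)) z ξ → |ξ.snd| ≤ B) ∧
      (∀ z : M × ℝ, z.2 ∈ Ioo (-δ) (T' - 3 * δ) → |V z| ≤ R ∧ V z ≤ f (z.1, z.2 + 2 * δ) ∧
        ∃ s, |s - (z.2 + 2 * δ)| < δ ∧ f (z.1, s) ≤ V z) := by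
  -- Large enough that, for times at most `T'`, a displacement of `δ` costs at least `2 * R + 1`,
  -- more than the oscillation `2 * R` of `f`.
  set l : ℝ := (2 * R + 1) * Real.exp (Λ * T') / δ ^ 2 with hl
  have hl0 : 0 < l := by positivity
  -- The shift by `2 * δ` keeps minimising times inside `(0, T')` while letting the regularised
  -- function live on an interval around `0`. The decaying weight makes the inf-convolution a
  -- subsolution even though `H` depends on `u`.
  set F : M × ℝ → ℝ → ℝ := fun z s =>
    f (z.1, s) + l * Real.exp (-(Λ * z.2)) * (z.2 + 2 * δ - s) ^ 2 with hF
  have hFlsc : LowerSemicontinuous fun q : (M × ℝ) × ℝ => F q.1 q.2 := by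
    refine LowerSemicontinuous.add ?_ (Continuous.lowerSemicontinuous (by fun_prop))
    exact hf.comp (g := fun q : (M × ℝ) × ℝ => (q.1.1, q.2)) (by fun_prop)
  have hmin : ∀ z, ∃ s ∈ Icc 0 T', ∀ s' ∈ Icc 0 T', F z s ≤ F z s' := fun z => by
    have h1 : LowerSemicontinuousOn (fun s => F z s) (Icc 0 T') :=
      (hFlsc.comp (g := fun s : ℝ => (z, s)) (by fun_prop)).lowerSemicontinuousOn _
    obtain ⟨s, hs, h2⟩ := h1.exists_isMinOn ⟨0, by simp [hT'.le]⟩ isCompact_Icc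
    exact ⟨s, hs, fun s' hs' => h2 hs'⟩
  choose S hS hSmin using hmin
  set J := Ioo (-δ) (T' - 3 * δ) with hJ
  have hfle : ∀ z, z.2 ∈ J → F z (S z) ≤ f (z.1, z.2 + 2 * δ) := fun z hz => by
    have h1 := hSmin z (z.2 + 2 * δ) ⟨by linarith [hz.1], by linarith [hz.2]⟩
    refine h1.trans (le_of_eq ?_)
    simp [hF]
  have hclose : ∀ z, z.2 ∈ J → |S z - (z.2 + 2 * δ)| < δ := fun z hz => by
    have h1 := hfle z hz
    have h2 := (abs_le.1 (hR (z.1, z.2 + 2 * δ))).2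
    have h3 := (abs_le.1 (hR (z.1, S z))).1
    have h4 : (2 * R + 1) / δ ^ 2 ≤ l * Real.exp (-(Λ * z.2)) := by
      have : 1 ≤ Real.exp (Λ * T') * Real.exp (-(Λ * z.2)) := by
        rw [← Real.exp_add, Real.one_le_exp_iff]
        have := mul_le_mul_of_nonneg_left (show z.2 ≤ T' by linarith [hz.2]) hΛ.le
        linarith
      calc (2 * R + 1) / δ ^ 2 = (2 * R + 1) / δ ^ 2 * 1 := by ring
        _ ≤ (2 * R + 1) / δ ^ 2 * (Real.exp (Λ * T') * Real.exp (-(Λ * z.2))) :=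
          mul_le_mul_of_nonneg_left this (by positivity)
        _ = l * Real.exp (-(Λ * z.2)) := by rw [hl]; ring
    have h5 : (2 * R + 1) / δ ^ 2 * (z.2 + 2 * δ - S z) ^ 2 ≤ 2 * R := by
      have := mul_le_mul_of_nonneg_right h4 (sq_nonneg (z.2 + 2 * δ - S z))
      simp only [hF] at h1
      linarith
    have h6 : (z.2 + 2 * δ - S z) ^ 2 < δ ^ 2 := by
      rw [div_mul_eq_mul_div, div_le_iff₀ (by positivity)] at h5
      by_contra! hge
      nlinarith [mul_le_mul_of_nonneg_left hge (show 0 ≤ 2 * R + 1 by linarith),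
        show 0 < δ ^ 2 by positivity]
    rw [abs_sub_comm]
    exact abs_lt_of_sq_lt_sq h6 hδ.le
  have hline : ∀ z w : ChartSpaceTime n, Tendsto (fun s : ℝ => z + s • w) (𝓝 0) (𝓝 z) := by
    intro z w
    have : Tendsto (fun s : ℝ => z + s • w) (𝓝 0) (𝓝 (z + (0 : ℝ) • w)) :=
      Continuous.tendsto (by fun_prop) _
    simpa using this
  refine ⟨fun z => F z (S z), l * Real.exp (Λ * δ) * (Λ * δ ^ 2 + 2 * δ), ?_, ?_, ?_, ?_⟩
  · intro z y hy
    have h1 : ∀ᶠ z' in 𝓝 z, ∀ s ∈ Icc 0 T', y < F z' s :=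
      isCompact_Icc.eventually_forall_of_forall_eventually fun s hs =>
        hFlsc (z, s) y (hy.trans_le (hSmin z s hs))
    filter_upwards [h1] with z' hz'
    exact hz' _ (hS z')
  · rintro x₀ z ξ hz hzJ ⟨σ, hσ⟩
    set q := chartPoint x₀ z with hq
    set c := l * Real.exp (-(Λ * z.snd)) * (z.snd + 2 * δ - S q) ^ 2 with hc
    have hc0 : 0 ≤ c := by positivity
    have hVq : F q (S q) = f (q.1, S q) + c := rfl
    have hSq := abs_lt.1 (hclose q hzJ)
    have hq2 : q.2 = z.snd := rfl
    have hSI : S q ∈ Ioo 0 T' := by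
      rw [hq2] at hSq
      exact ⟨by linarith [hzJ.1], by linarith [hzJ.2]⟩
    set z₁ : ChartSpaceTime n := WithLp.toLp 2 (z.fst, S q) with hz₁
    have hcp : chartPoint x₀ z₁ = (q.1, S q) := rfl
    -- Differentiating the weight adds `Λ * c` to the time slope, where `c` is the penalty, that is,
    -- the regularised value minus `f` at the minimising time. This is exactly the Lipschitz error
    -- from changing the argument `u` of `H`.
    set ξ₁ : ChartSpaceTime n := WithLp.toLp 2 (ξ.fst, ξ.snd + Λ * c) with hξ₁
    have hprox : IsProxSubgrad (fun z => f (chartPoint x₀ z)) z₁ ξ₁ := by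
      refine ⟨σ + c * Λ ^ 2, ?_⟩
      have ht : Tendsto (fun z' : ChartSpaceTime n => z + (z' - z₁)) (𝓝 z₁) (𝓝 z) := by
        have : Tendsto (fun z' : ChartSpaceTime n => z + (z' - z₁)) (𝓝 z₁) (𝓝 (z + (z₁ - z₁))) :=
          Continuous.tendsto (by fun_prop) _
        simpa using this
      have hI : ∀ᶠ z' : ChartSpaceTime n in 𝓝 z₁, z'.snd ∈ Ioo 0 T' :=
        continuous_spaceTime_snd.continuousAt.eventually (isOpen_Ioo.mem_nhds hSI)
      have hsmall : ∀ᶠ z' : ChartSpaceTime n in 𝓝 z₁, |Λ * (z'.snd - S q)| < 1 := by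
        have h1 : Continuous fun z' : ChartSpaceTime n => |Λ * (z'.snd - S q)| :=
          (continuous_const.mul (continuous_spaceTime_snd.sub continuous_const)).abs
        refine h1.continuousAt.eventually_lt_const ?_
        simp [hz₁]
      filter_upwards [ht.eventually hσ, hI, hsmall] with z' h1 h2 h3
      set d := z' - z₁ with hd
      have hdsnd : d.snd = z'.snd - S q := rfl
      have hdfst : z'.fst = z.fst + d.fst := by
        rw [hd, hz₁]
        simp
      rw [add_sub_cancel_left] at h1
      have h4 : F (chartPoint x₀ (z + d)) (S (chartPoint x₀ (z + d))) ≤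
          f (chartPoint x₀ z') + c * Real.exp (-(Λ * d.snd)) := by
        refine (hSmin _ z'.snd (Ioo_subset_Icc_self h2)).trans (le_of_eq ?_)
        have h5 : (chartPoint x₀ (z + d)).1 = (chartPoint x₀ z').1 := by
          simp only [chartPoint, WithLp.add_fst, hdfst]
        have h6 : (chartPoint x₀ (z + d)).2 = z.snd + d.snd := rfl
        have h7 : z.snd + d.snd + 2 * δ - z'.snd = z.snd + 2 * δ - S q := by rw [hdsnd]; ring
        have h8 : -(Λ * (z.snd + d.snd)) = -(Λ * z.snd) + -(Λ * d.snd) := by ring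
        simp only [hF, h5, h6, h7, h8, Real.exp_add]
        rw [hc]
        change f (chartPoint x₀ z') + _ = _
        ring
      have h5 := mul_le_mul_of_nonneg_left (exp_neg_sub_bound (x := Λ * d.snd) h3.le) hc0
      have h6 : inner ℝ ξ₁ d = inner ℝ ξ d + Λ * c * d.snd := by
        rw [spaceTime_inner_eq, spaceTime_inner_eq, hξ₁]
        simp only [WithLp.toLp_fst, WithLp.toLp_snd]
        ring
      have h7 : d.snd ^ 2 ≤ ‖d‖ ^ 2 := by
        rw [spaceTime_norm_sq_eq]
        linarith [sq_nonneg ‖d.fst‖]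
      have h8 := mul_le_mul_of_nonneg_left h7 (show 0 ≤ c * Λ ^ 2 by positivity)
      rw [h6]
      have h1' : f (q.1, S q) + c + inner ℝ ξ d - σ * ‖d‖ ^ 2 ≤
        F (chartPoint x₀ (z + d)) (S (chartPoint x₀ (z + d))) := h1
      change f (q.1, S q) + _ - _ ≤ _
      nlinarith
    have h1 := hsub x₀ z₁ ξ₁ hz hSI hprox
    have h2 := hH4 ((extChartAt (𝓡 n) x₀).symm z.fst) (chartCovector x₀ _ ξ.fst) (F q (S q))
      (f (q.1, S q))
    have h3 : F q (S q) - f (q.1, S q) = c := by rw [hVq]; ring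
    rw [h3, abs_of_nonneg hc0] at h2
    have h4 := (abs_le.1 h2).2
    change ξ.snd + Λ * c + H ((extChartAt (𝓡 n) x₀).symm z.fst) (chartCovector x₀ _ ξ.fst)
      (f (q.1, S q)) ≤ 0 at h1
    change ξ.snd + H ((extChartAt (𝓡 n) x₀).symm z.fst) (chartCovector x₀ _ ξ.fst)
      (F q (S q)) ≤ 0
    linarith
  · intro x₀ z ξ hzJ hξ
    set q := chartPoint x₀ z with hq
    set a := z.snd + 2 * δ - S q with ha
    have haδ : |a| < δ := by
      rw [ha, abs_sub_comm]
      exact hclose q hzJ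
    -- Freezing the minimising time gives a smooth function of time touching from above, which
    -- determines the time slope.
    have hw := hξ.inner_eq (w := WithLp.toLp 2 (0, 1))
      (g := fun h => f (q.1, S q) + l * Real.exp (-(Λ * (z.snd + h))) * (a + h) ^ 2)
      (d := l * Real.exp (-(Λ * z.snd)) * (2 * a - Λ * a ^ 2)) (by
        have h1 : HasDerivAt (fun h : ℝ => -(Λ * (z.snd + h))) (-Λ) 0 := by
          exact HasDerivAt.congr_deriv (((hasDerivAt_id (0 : ℝ)).const_add z.snd).const_mul Λ).neg
            (by simp)
        have h2 : HasDerivAt (fun h : ℝ => (a + h) ^ 2) (2 * a) 0 := by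
          exact HasDerivAt.congr_deriv (((hasDerivAt_id (0 : ℝ)).const_add a).pow 2) (by simp)
        refine HasDerivAt.congr_deriv (((h1.exp.const_mul l).mul h2).const_add _) ?_
        simp only [add_zero]
        ring) (by simp [hF, ha, hq, chartPoint]) (by
        refine Eventually.of_forall fun h => ?_
        refine (hSmin _ (S q) (hS q)).trans (le_of_eq ?_)
        have h5 : (chartPoint x₀ (z + h • WithLp.toLp 2 (0, 1) : ChartSpaceTime n)).1 = q.1 := by
          simp [chartPoint, hq]
        have h6 : (chartPoint x₀ (z + h • WithLp.toLp 2 (0, 1) : ChartSpaceTime n)).2 =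
          z.snd + h := by simp [chartPoint]
        simp only [hF, h5, h6, ha]
        ring)
    have h1 : inner ℝ ξ (WithLp.toLp 2 (0, 1) : ChartSpaceTime n) = ξ.snd := by
      rw [spaceTime_inner_eq]
      simp
    rw [← h1, hw, abs_mul, abs_of_nonneg (by positivity)]
    have h2 : Real.exp (-(Λ * z.snd)) ≤ Real.exp (Λ * δ) := by
      refine Real.exp_le_exp.2 ?_
      nlinarith [hzJ.1]
    have h3 : |2 * a - Λ * a ^ 2| ≤ Λ * δ ^ 2 + 2 * δ := by
      have h4 : a ^ 2 ≤ δ ^ 2 := sq_le_sq' (abs_lt.1 haδ).1.le (abs_lt.1 haδ).2.le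
      have h5 := mul_le_mul_of_nonneg_left h4 hΛ.le
      have h6 : 0 ≤ Λ * a ^ 2 := by positivity
      rw [abs_le]
      constructor <;> linarith [(abs_lt.1 haδ).1, (abs_lt.1 haδ).2]
    exact mul_le_mul (mul_le_mul_of_nonneg_left h2 hl0.le) h3 (abs_nonneg _) (by positivity)
  · intro z hz
    have h1 := hfle z hz
    have h2 : 0 ≤ l * Real.exp (-(Λ * z.2)) * (z.2 + 2 * δ - S z) ^ 2 := by positivity
    have h3 : f (z.1, S z) ≤ F z (S z) := by simp only [hF]; linarith
    refine ⟨abs_le.2 ⟨?_, ?_⟩, h1, S z, hclose z hz, h3⟩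
    · exact (abs_le.1 (hR _)).1.trans h3
    · exact h1.trans (abs_le.1 (hR _)).2

end TimeRegularity

/-! ### Comparison for regularised subsolutions. -/

section Comparison

variable {n : ℕ} {M : Type*} [TopologicalSpace M] [ChartedSpace (EuclideanSpace ℝ (Fin n)) M]
  [IsManifold (𝓡 n) ∞ M] [RiemannianBundle (fun x : M => TangentSpace (𝓡 n) x)]
  [IsContMDiffRiemannianBundle (𝓡 n) ∞ (EuclideanSpace ℝ (Fin n))
    (fun x : M => TangentSpace (𝓡 n) x)]
  {H : (x : M) → CotSpace n M x → ℝ → ℝ}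

/-- The proximal subgradients of a bounded subsolution with bounded time slopes are locally bounded
in charts. -/
theorem IsProxSubsolution.exists_ball_norm_le (hH1 : HamContinuous H) (hH2 : HamCoercive H)
    {V : M × ℝ → ℝ} {R B : ℝ} {I J : Set ℝ} (hI : IsOpen I) (hIJ : I ⊆ J)
    (hV : IsProxSubsolution H J V) (hR : ∀ z : M × ℝ, z.2 ∈ J → |V z| ≤ R)
    (hB : ∀ (x₀ : M) (z ξ : ChartSpaceTime n), z.snd ∈ J →
      IsProxSubgrad (fun z => V (chartPoint x₀ z)) z ξ → |ξ.snd| ≤ B)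
    (x₁ : M) {t₁ : ℝ} (ht₁ : t₁ ∈ I) :
    ∃ r > 0, ∃ L : ℝ, ∀ z ∈ Metric.ball (WithLp.toLp 2 (extChartAt (𝓡 n) x₁ x₁, t₁) :
      ChartSpaceTime n) r, z.fst ∈ (extChartAt (𝓡 n) x₁).target ∧ z.snd ∈ I ∧
        ∀ ξ, IsProxSubgrad (fun z => V (chartPoint x₁ z)) z ξ → ‖ξ‖ ≤ L := by
  obtain ⟨ρ, hρ, K, _C, hball, hC⟩ := exists_chartHam_bounds hH1 hH2 x₁ R B
  have hopen : IsOpen {z : ChartSpaceTime n |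
      z.fst ∈ Metric.ball (extChartAt (𝓡 n) x₁ x₁) ρ ∧ z.snd ∈ I} :=
    isOpen_spaceTime Metric.isOpen_ball hI
  obtain ⟨r, hr, hsub⟩ := Metric.isOpen_iff.1 hopen
    (WithLp.toLp 2 (extChartAt (𝓡 n) x₁ x₁, t₁)) ⟨Metric.mem_ball_self hρ, ht₁⟩
  refine ⟨r, hr, |K| + |B|, fun z hz => ⟨hball (hsub hz).1, (hsub hz).2, fun ξ hξ => ?_⟩⟩
  have h1 := hB x₁ z ξ (hIJ (hsub hz).2) hξ
  have h2 := hV x₁ z ξ (hball (hsub hz).1) (hIJ (hsub hz).2) hξ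
  -- The equation and the bound on the time slope give `H ≤ B`, and coercivity bounds the space
  -- slope.
  have h3 := (hC z.fst (hsub hz).1 ξ.fst _ (hR (chartPoint x₁ z) (hIJ (hsub hz).2))).2
    (by linarith [(abs_le.1 h1).1])
  refine abs_le_of_sq_le_sq' (a := ‖ξ‖) ?_ (by positivity) |>.2
  rw [spaceTime_norm_sq_eq]
  have h4 : ‖ξ.fst‖ ^ 2 ≤ |K| ^ 2 := pow_le_pow_left₀ (norm_nonneg _) (h3.trans (le_abs_self K)) 2
  have h5 : ξ.snd ^ 2 ≤ |B| ^ 2 := by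
    rw [← sq_abs ξ.snd]
    exact pow_le_pow_left₀ (abs_nonneg _) (h1.trans (le_abs_self B)) 2
  nlinarith [mul_nonneg (abs_nonneg K) (abs_nonneg B)]

/-- Locally bounded proximal subgradients make `V` Lipschitz in charts. Continuity is what makes `g
- V` lower semicontinuous in the comparison. -/
theorem IsProxSubsolution.continuousAt (hH1 : HamContinuous H) (hH2 : HamCoercive H)
    {V : M × ℝ → ℝ} (hVlsc : LowerSemicontinuous V) {R B : ℝ} {J : Set ℝ} (hJ : IsOpen J)
    (hV : IsProxSubsolution H J V) (hR : ∀ z : M × ℝ, z.2 ∈ J → |V z| ≤ R)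
    (hB : ∀ (x₀ : M) (z ξ : ChartSpaceTime n), z.snd ∈ J →
      IsProxSubgrad (fun z => V (chartPoint x₀ z)) z ξ → |ξ.snd| ≤ B)
    {q : M × ℝ} (hq : q.2 ∈ J) : ContinuousAt V q := by
  obtain ⟨r, hr, L, hL⟩ := hV.exists_ball_norm_le hH1 hH2 hJ subset_rfl hR hB q.1 hq
  set z₁ : ChartSpaceTime n := WithLp.toLp 2 (extChartAt (𝓡 n) q.1 q.1, q.2) with hz₁
  have hlip : LipschitzOnWith L.toNNReal (fun z => V (chartPoint q.1 z)) (Metric.ball z₁ r) := by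
    refine LipschitzOnWith.of_le_add_mul _ fun y hy z hz => ?_
    have h1 := le_add_mul_norm_of_proxSubgrad_norm_le (u := fun z => V (chartPoint q.1 z))
      Metric.isOpen_ball (convex_ball z₁ r)
      (lowerSemicontinuousOn_comp_chartPoint hVlsc q.1 fun z hz => (hL z hz).1)
      (fun z hz => (hL z hz).2.2) hz hy
    have h2 : L * ‖y - z‖ ≤ L.toNNReal * ‖y - z‖ :=
      mul_le_mul_of_nonneg_right (Real.le_coe_toNNReal L) (norm_nonneg _)
    rw [dist_eq_norm]
    linarith
  have hc : ContinuousAt (fun z => V (chartPoint q.1 z)) z₁ :=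
    hlip.continuousOn.continuousAt (Metric.ball_mem_nhds _ hr)
  have he : ContinuousAt (fun q' : M × ℝ =>
      (WithLp.toLp 2 (extChartAt (𝓡 n) q.1 q'.1, q'.2) : ChartSpaceTime n)) q := by
    refine (WithLp.prod_continuous_toLp 2 _ _).continuousAt.comp ?_
    exact ((continuousAt_extChartAt q.1).comp_of_eq continuousAt_fst rfl).prodMk continuousAt_snd
  refine (hc.comp_of_eq he rfl).congr ?_
  have hsrc : (extChartAt (𝓡 n) q.1).source ×ˢ (univ : Set ℝ) ∈ 𝓝 q :=
    prod_mem_nhds (extChartAt_source_mem_nhds (I := 𝓡 n) q.1) univ_mem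
  filter_upwards [hsrc] with q' hq'
  exact congrArg V (Prod.ext ((extChartAt (𝓡 n) q.1).left_inv hq'.1) rfl)

theorem LowerSemicontinuousOn.mul_continuous_nonneg {X : Type*} [TopologicalSpace X] {S : Set X}
    {f h : X → ℝ} (hf : LowerSemicontinuousOn f S) (hh : Continuous h) (h0 : ∀ x ∈ S, 0 ≤ h x) :
    LowerSemicontinuousOn (fun x => f x * h x) S := by
  intro x hx y hy
  obtain ⟨ε, hε, hyε⟩ : ∃ ε > 0, y < (f x - ε) * h x := by
    refine ⟨(f x * h x - y) / (2 * (h x + 1)), div_pos (by linarith) ?_, ?_⟩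
    · linarith [h0 x hx]
    · have h1 := h0 x hx
      have h2 : (f x * h x - y) / (2 * (h x + 1)) * h x ≤ (f x * h x - y) / 2 := by
        rw [div_mul_eq_mul_div, div_le_div_iff₀ (by linarith) (by norm_num)]
        nlinarith
      have h3 : y < f x * h x := hy
      rw [sub_mul]
      linarith
  have h1 := hf x hx (f x - ε) (by change f x - ε < f x; linarith)
  have h2 : ∀ᶠ x' in 𝓝 x, y < (f x - ε) * h x' :=
    (continuous_const.mul hh).continuousAt.eventually_const_lt hyε
  filter_upwards [h1, nhdsWithin_le_nhds h2, self_mem_nhdsWithin] with x' h3 h4 h5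
  exact h4.trans_le (mul_le_mul_of_nonneg_right (le_of_lt h3) (h0 x' h5))

/-- Comparison between a regular subsolution and a lower semicontinuous supersolution. -/
theorem IsProxSubsolution.sub_mul_le [CompactSpace M] (hH1 : HamContinuous H)
    (hH2 : HamCoercive H) (hH3 : HamConvex H) {Λ : ℝ} (hΛ : 0 < Λ)
    (hH4 : ∀ (x : M) (p : CotSpace n M x) (u v : ℝ), |H x p u - H x p v| ≤ Λ * |u - v|)
    {V g : M × ℝ → ℝ} {R B N κ a b T : ℝ} (ha : a < 0) (hT : 0 < T) (hTb : T < b)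
    (hVlsc : LowerSemicontinuous V) (hV : IsProxSubsolution H (Ioo a b) V)
    (hR : ∀ z : M × ℝ, z.2 ∈ Ioo a b → |V z| ≤ R)
    (hB : ∀ (x₀ : M) (z ξ : ChartSpaceTime n), z.snd ∈ Ioo a b →
      IsProxSubgrad (fun z => V (chartPoint x₀ z)) z ξ → |ξ.snd| ≤ B)
    (hglsc : LowerSemicontinuous g) (hg : IsProxSupersolution H (Ioo 0 T) N g) (hRN : R < N)
    (hκ : 0 ≤ κ) (h0 : ∀ x, V (x, 0) ≤ g (x, 0) + κ) (x : M) {t : ℝ} (ht : t ∈ Ico 0 T) :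
    (V (x, t) - g (x, t)) * ((T - t) * Real.exp (-(2 * Λ * t))) ≤ T * κ := by
  -- The factor `T - t` excludes a positive maximum of `(V - g) * h` at time `T`; the exponential
  -- rate `2 * Λ` exceeds the Lipschitz constant of `H` in `u`.
  set h : ℝ → ℝ := fun t => (T - t) * Real.exp (-(2 * Λ * t)) with hh
  have hsubset : ∀ z : M × ℝ, z.2 ∈ Icc 0 T → z.2 ∈ Ioo a b := fun z hz =>
    ⟨ha.trans_le hz.1, hz.2.trans_lt hTb⟩
  have hVc : ContinuousOn V {z : M × ℝ | z.2 ∈ Icc 0 T} := fun z hz =>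
    (hV.continuousAt hH1 hH2 hVlsc isOpen_Ioo hR hB (hsubset z hz)).continuousWithinAt
  have hFlsc : LowerSemicontinuousOn (fun z : M × ℝ => (g z + -V z) * h z.2)
      {z : M × ℝ | z.2 ∈ Icc 0 T} := by
    refine LowerSemicontinuousOn.mul_continuous_nonneg ?_ (by fun_prop) fun z hz =>
      mul_nonneg (by linarith [hz.2]) (Real.exp_pos _).le
    exact (hglsc.lowerSemicontinuousOn _).add hVc.neg.lowerSemicontinuousOn
  have hcomp : IsCompact {z : M × ℝ | z.2 ∈ Icc 0 T} := by
    have : {z : M × ℝ | z.2 ∈ Icc 0 T} = univ ×ˢ Icc 0 T := by ext z; simp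
    rw [this]
    exact isCompact_univ.prod isCompact_Icc
  obtain ⟨⟨x₁, t₁⟩, ht₁, hmin⟩ := hFlsc.exists_isMinOn
    (show ({z : M × ℝ | z.2 ∈ Icc 0 T}).Nonempty from ⟨(x, t), ht.1, ht.2.le⟩) hcomp
  have hmin' : ∀ z : M × ℝ, z.2 ∈ Icc 0 T →
    (g (x₁, t₁) - V (x₁, t₁)) * h t₁ ≤ (g z - V z) * h z.2 := fun z hz => hmin hz
  set θ := (V (x₁, t₁) - g (x₁, t₁)) * h t₁ with hθ
  have hle : ∀ z : M × ℝ, z.2 ∈ Icc 0 T → (V z - g z) * h z.2 ≤ θ := fun z hz => by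
    rw [hθ]
    linarith [hmin' z hz]
  by_contra! hcon
  have hTκ : 0 ≤ T * κ := by positivity
  have hθκ : T * κ < θ := hcon.trans_le (hle (x, t) ⟨ht.1, ht.2.le⟩)
  have hθ0 : 0 < θ := hTκ.trans_lt hθκ
  have ht₁T : t₁ < T := by
    refine lt_of_le_of_ne ht₁.2 fun heq => ?_
    have h1 : h t₁ = 0 := by simp only [hh, heq]; ring
    rw [hθ, h1, mul_zero] at hθ0
    exact lt_irrefl _ hθ0
  have ht₁0 : 0 < t₁ := by
    refine lt_of_le_of_ne ht₁.1 fun heq => ?_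
    change 0 = t₁ at heq
    subst heq
    have h1 : h 0 = T := by simp [hh]
    rw [hθ, h1] at hθκ
    have := mul_le_mul_of_nonneg_left (sub_le_iff_le_add'.2 (h0 x₁)) hT.le
    linarith
  have hhpos : ∀ s, s < T → 0 < h s := fun s hs => mul_pos (by linarith) (Real.exp_pos _)
  -- Dividing the maximality inequality by `h` says that `V - ψ ≤ g`, with equality at the maximum
  -- point.
  set ψ : ℝ → ℝ := fun s => θ / h s with hψ
  have hhd : ∀ s, HasDerivAt h (-Real.exp (-(2 * Λ * s)) - 2 * Λ * h s) s := fun s => by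
    have h1 : HasDerivAt (fun s : ℝ => T - s) (-1) s := (hasDerivAt_id s).const_sub T
    have h2 : HasDerivAt (fun s : ℝ => -(2 * Λ * s)) (-(2 * Λ * 1)) s :=
      ((hasDerivAt_id s).const_mul (2 * Λ)).neg
    refine HasDerivAt.congr_deriv (h1.mul h2.exp) ?_
    simp only [hh]
    ring
  set ψ' : ℝ → ℝ := fun s => θ * (Real.exp (-(2 * Λ * s)) + 2 * Λ * h s) / h s ^ 2 with hψ'
  have hψd : ∀ s, s < T → HasDerivAt ψ (ψ' s) s := fun s hs => by
    refine HasDerivAt.congr_deriv ((hasDerivAt_const s θ).div (hhd s) (hhpos s hs).ne') ?_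
    simp only [hψ']
    ring
  have hhc : Continuous h := by fun_prop
  have hψ'c : ContinuousAt ψ' t₁ := by
    refine ContinuousAt.div ?_ (hhc.pow 2).continuousAt (pow_ne_zero 2 (hhpos t₁ ht₁T).ne')
    fun_prop
  have hψ'gt : Λ * ψ t₁ < ψ' t₁ := by
    have hp := hhpos t₁ ht₁T
    have he := Real.exp_pos (-(2 * Λ * t₁))
    simp only [hψ, hψ']
    rw [← mul_div_assoc, div_lt_div_iff₀ hp (by positivity)]
    have h1 : Λ * θ * h t₁ ^ 2 < θ * (Real.exp (-(2 * Λ * t₁)) + 2 * Λ * h t₁) * h t₁ := by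
      have h2 : 0 < θ * Real.exp (-(2 * Λ * t₁)) * h t₁ := by positivity
      have h3 : 0 < Λ * θ * h t₁ ^ 2 := by positivity
      linarith
    exact h1
  obtain ⟨r, hr, L, hL⟩ := hV.exists_ball_norm_le hH1 hH2 (isOpen_Ioo (a := 0) (b := T))
    (show Ioo 0 T ⊆ Ioo a b from fun s hs => ⟨ha.trans hs.1, hs.2.trans hTb⟩) hR hB x₁ (t₁ := t₁)
    (show t₁ ∈ Ioo 0 T from ⟨ht₁0, ht₁T⟩)
  set z₁ : ChartSpaceTime n := WithLp.toLp 2 (extChartAt (𝓡 n) x₁ x₁, t₁) with hz₁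
  have hcp : chartPoint x₁ z₁ = (x₁, t₁) :=
    Prod.ext ((extChartAt (𝓡 n) x₁).left_inv (mem_extChartAt_source x₁)) rfl
  have hVψ : V (x₁, t₁) - ψ t₁ = g (x₁, t₁) := by
    have hp := hhpos t₁ ht₁T
    simp only [hψ, hθ]
    field_simp
    ring
  have hψpos : 0 < ψ t₁ := div_pos hθ0 (hhpos t₁ ht₁T)
  -- With a common slope, subtracting the two inequalities gives `ψ' t₁ ≤ Λ * ψ t₁`, against
  -- `hψ'gt`.
  obtain ⟨ξ, hξ1, hξ2⟩ := exists_common_slope (V := fun z => V (chartPoint x₁ z))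
    (W := fun z => g (chartPoint x₁ z)) (ψ := fun z => ψ z.snd)
    (Dψ := fun z => WithLp.toLp 2 (0, ψ' z.snd))
    (G := fun z ξ s => ξ.snd + chartHam H x₁ z.fst ξ.fst s) (z₀ := z₁) (L := L) (N := N) hr
    (lowerSemicontinuousOn_comp_chartPoint hVlsc x₁ fun z hz => (hL z hz).1)
    (lowerSemicontinuousOn_comp_chartPoint hglsc x₁ fun z hz => (hL z hz).1)
    (fun z hz => by
      rw [hasGradientAt_iff_hasFDerivAt]
      have h1 : HasFDerivAt (fun z : ChartSpaceTime n => z.snd)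
          ((ContinuousLinearMap.snd ℝ (EuclideanSpace ℝ (Fin n)) ℝ).comp
            (WithLp.prodContinuousLinearEquiv 2 ℝ (EuclideanSpace ℝ (Fin n)) ℝ :
              ChartSpaceTime n →L[ℝ] EuclideanSpace ℝ (Fin n) × ℝ)) z :=
        ((ContinuousLinearMap.snd ℝ (EuclideanSpace ℝ (Fin n)) ℝ).comp
            (WithLp.prodContinuousLinearEquiv 2 ℝ (EuclideanSpace ℝ (Fin n)) ℝ :
              ChartSpaceTime n →L[ℝ] EuclideanSpace ℝ (Fin n) × ℝ)).hasFDerivAt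
      refine HasFDerivAt.congr_fderiv
        ((hψd z.snd (hL z hz).2.1.2).comp_hasFDerivAt z h1) ?_
      ext w
      rw [InnerProductSpace.toDual_apply_apply, spaceTime_inner_eq]
      simp)
    (by
      refine (WithLp.prod_continuous_toLp 2 _ _).continuousAt.comp ?_
      exact continuousAt_const.prodMk
        (hψ'c.comp_of_eq continuous_spaceTime_snd.continuousAt rfl))
    (by
      refine ContinuousOn.add ?_ ?_
      · exact (continuous_spaceTime_snd.comp (continuous_fst.comp continuous_snd)).continuousOn
      · refine (continuousOn_chartHam hH1 x₁).comp
          (f := fun q : ChartSpaceTime n × ChartSpaceTime n × ℝ => (q.1.fst, q.2.1.fst, q.2.2))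
          (Continuous.continuousOn ?_) fun q hq => ⟨(hL _ hq.1).1, mem_univ _⟩
        exact (continuous_spaceTime_fst.comp continuous_fst).prodMk
          ((continuous_spaceTime_fst.comp (continuous_fst.comp continuous_snd)).prodMk
            (continuous_snd.comp continuous_snd)))
    (fun s => by
      refine ⟨convex_univ, fun p _ q _ c d hc hd hcd => ?_⟩
      have h1 := (convexOn_chartHam hH3 x₁ z₁.fst s).2 (mem_univ p.fst) (mem_univ q.fst) hc hd hcd
      simp only [WithLp.add_fst, WithLp.add_snd, WithLp.smul_fst, WithLp.smul_snd,
        smul_eq_mul] at h1 ⊢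
      linarith)
    (fun z hz ξ hξ => ⟨(hL z hz).2.2 ξ hξ, hV x₁ z ξ (hL z hz).1
      (hsubset (chartPoint x₁ z) (Ioo_subset_Icc_self (hL z hz).2.1)) hξ⟩)
    (fun z hz ξ hξ hN => hg x₁ z ξ (hL z hz).1 (hL z hz).2.1 hξ hN)
    (fun z hz => by
      have h1 := hle (chartPoint x₁ z) (Ioo_subset_Icc_self (hL z hz).2.1)
      have h2 : V (chartPoint x₁ z) - g (chartPoint x₁ z) ≤ θ / h z.snd :=
        (le_div_iff₀ (hhpos _ (hL z hz).2.1.2)).2 h1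
      simp only [hψ]
      linarith)
    (by simp only [hcp]; exact hVψ)
    (by
      have h1 := (abs_le.1 (hR (x₁, t₁) (hsubset _ ht₁))).2
      simp only [hcp]
      linarith)
  rw [hcp] at hξ1 hξ2
  have h1 := hH4 ((extChartAt (𝓡 n) x₁).symm z₁.fst) (chartCovector x₁ _ ξ.fst) (g (x₁, t₁))
    (V (x₁, t₁))
  have h2 : |g (x₁, t₁) - V (x₁, t₁)| = ψ t₁ := by
    rw [← hVψ, abs_sub_comm, sub_sub_cancel, abs_of_pos hψpos]
  rw [h2] at h1
  have h3 := (abs_le.1 h1).2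
  simp only [WithLp.add_fst, WithLp.add_snd, chartHam] at hξ1 hξ2
  have h4 : (z₁ : ChartSpaceTime n).snd = t₁ := rfl
  rw [h4] at hξ1
  change ξ.snd + ψ' t₁ + H _ (chartCovector x₁ _ (ξ.fst + 0)) _ ≤ 0 at hξ1
  rw [add_zero] at hξ1
  linarith

end Comparison

/-! ### Removal of the regularisation. -/

section ComparisonOfTruncations

variable {n : ℕ} {M : Type*} [TopologicalSpace M] [ChartedSpace (EuclideanSpace ℝ (Fin n)) M]
  [IsManifold (𝓡 n) ∞ M] [CompactSpace M]
  [RiemannianBundle (fun x : M => TangentSpace (𝓡 n) x)]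
  [IsContMDiffRiemannianBundle (𝓡 n) ∞ (EuclideanSpace ℝ (Fin n))
    (fun x : M => TangentSpace (𝓡 n) x)]
  {H : (x : M) → CotSpace n M x → ℝ → ℝ}

/-- The growth hypothesis at time `2 * δ` makes the initial error of the regularised function `2 * C
* δ`. That function dominates a value of `f` at a time within `3 * δ` of `t`, so lower
semicontinuity of `f` gives the claim as `δ` tends to zero. -/
theorem IsProxSubsolution.le_of_isProxSupersolution (hH1 : HamContinuous H) (hH2 : HamCoercive H)
    (hH3 : HamConvex H) {Λ : ℝ} (hΛ : 0 < Λ)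
    (hH4 : ∀ (x : M) (p : CotSpace n M x) (u v : ℝ), |H x p u - H x p v| ≤ Λ * |u - v|)
    {f g : M × ℝ → ℝ} {R N C T' : ℝ} (hflsc : LowerSemicontinuous f)
    (hf : IsProxSubsolution H (Ioo 0 T') f) (hR0 : 0 ≤ R) (hR : ∀ z, |f z| ≤ R)
    (hglsc : LowerSemicontinuous g) (hg : IsProxSupersolution H (Ioo 0 T') N g) (hRN : R < N)
    (hC : 0 ≤ C) (h0 : ∀ x, ∀ s ∈ Ioo 0 T', f (x, s) ≤ g (x, 0) + C * s) (x : M) {t : ℝ}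
    (ht : t ∈ Ico 0 T') : f (x, t) ≤ g (x, t) := by
  obtain ⟨ht0, htT⟩ := ht
  -- For `δ < (T' - t) / 8` the weight on `[0, T' - 4 * δ]` satisfies `T' - 4 * δ - t ≥ (T' - t) /
  -- 2`, so `K` does not depend on `δ`.
  set K : ℝ := T' * (2 * C) / ((T' - t) / 2 * Real.exp (-(2 * Λ * t))) with hK
  have hden : 0 < (T' - t) / 2 * Real.exp (-(2 * Λ * t)) :=
    mul_pos (by linarith) (Real.exp_pos _)
  have key : ∀ δ, 0 < δ → δ < (T' - t) / 8 →
      ∃ s, |s - (t + 2 * δ)| < δ ∧ f (x, s) ≤ g (x, t) + K * δ := by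
    intro δ hδ hδt
    obtain ⟨V, B, hVlsc, hV, hB, hVR⟩ :=
      hf.exists_regularization hΛ hH4 hflsc hR0 hR (by linarith) hδ
    have h1 := hV.sub_mul_le hH1 hH2 hH3 hΛ hH4 (a := -δ) (b := T' - 3 * δ) (T := T' - 4 * δ)
      (g := g) (N := N) (κ := 2 * C * δ) (by linarith) (by linarith) (by linarith) hVlsc
      (fun z hz => (hVR z hz).1) hB hglsc
      (fun x₀ z ξ hz hzI => hg x₀ z ξ hz ⟨hzI.1, hzI.2.trans (by linarith)⟩) hRN (by positivity)
      (fun y => by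
        have h2 := (hVR (y, 0) ⟨by simpa using hδ, show (0 : ℝ) < _ by linarith⟩).2.1
        have h3 := h0 y (0 + 2 * δ) ⟨by linarith, by linarith⟩
        change V (y, 0) ≤ f (y, 0 + 2 * δ) at h2
        linarith) x (t := t) ⟨ht0, by linarith⟩
    obtain ⟨-, -, s, hs, hsV⟩ := hVR (x, t) ⟨show -δ < t by linarith, show t < _ by linarith⟩
    refine ⟨s, hs, ?_⟩
    change f (x, s) ≤ V (x, t) at hsV
    suffices V (x, t) - g (x, t) ≤ K * δ by linarith
    rcases le_or_gt (V (x, t) - g (x, t)) 0 with hle | hlt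
    · refine hle.trans (mul_nonneg (div_nonneg ?_ hden.le) hδ.le)
      exact mul_nonneg (by linarith) (by linarith)
    · rw [hK, div_mul_eq_mul_div, le_div_iff₀ hden]
      calc (V (x, t) - g (x, t)) * ((T' - t) / 2 * Real.exp (-(2 * Λ * t)))
          ≤ (V (x, t) - g (x, t)) * ((T' - 4 * δ - t) * Real.exp (-(2 * Λ * t))) := by
            gcongr
            linarith
        _ ≤ (T' - 4 * δ) * (2 * C * δ) := h1
        _ ≤ T' * (2 * C * δ) := by
            gcongr
            linarith
        _ = T' * (2 * C) * δ := by ring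
  by_contra! hcon
  obtain ⟨y, hy1, hy2⟩ := exists_between hcon
  have hev : ∀ᶠ s in 𝓝 t, y < f (x, s) :=
    (Continuous.continuousAt (f := fun s : ℝ => (x, s)) (by fun_prop)).eventually
      (hflsc (x, t) y hy2)
  obtain ⟨r, hr, hball⟩ := Metric.eventually_nhds_iff.1 hev
  have hsmall : ∀ᶠ δ in 𝓝[>] (0 : ℝ), δ < (T' - t) / 8 ∧ 3 * δ < r ∧ g (x, t) + K * δ < y := by
    refine Filter.Eventually.filter_mono nhdsWithin_le_nhds ?_
    refine (eventually_lt_nhds (by linarith)).and (Filter.Eventually.and ?_ ?_)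
    · exact (Continuous.continuousAt (by fun_prop)).eventually_lt_const (by simpa using hr)
    · exact (Continuous.continuousAt (by fun_prop)).eventually_lt_const (by simpa using hy1)
  obtain ⟨δ, ⟨h1, h2, h3⟩, hδ⟩ := (hsmall.and self_mem_nhdsWithin).exists
  obtain ⟨s, hs, hle⟩ := key δ hδ h1
  have hδ' : 0 < δ := hδ
  have h4 : dist s t < r := by
    rw [Real.dist_eq, abs_lt]
    have := abs_lt.1 hs
    constructor <;> linarith
  linarith [hball h4]

end ComparisonOfTruncations

/-! ### Truncation levels, initial data and conclusion. -/

/-- Comparison principle for lower semicontinuous (Barron–Jensen) sub- and supersolutions of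
`u_t + H(x, D_x u, u) = 0` on a connected closed smooth Riemannian manifold `M`. -/
theorem theorem2p1 (n : ℕ) (M : Type*) [TopologicalSpace M]
    [ChartedSpace (EuclideanSpace ℝ (Fin n)) M] [IsManifold (𝓡 n) ∞ M]
    [T2Space M] [CompactSpace M] [ConnectedSpace M]
    [RiemannianBundle (fun x : M => TangentSpace (𝓡 n) x)]
    [IsContMDiffRiemannianBundle (𝓡 n) ∞ (EuclideanSpace ℝ (Fin n))
      (fun x : M => TangentSpace (𝓡 n) x)]
    (H : (x : M) → CotSpace n M x → ℝ → ℝ)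
    (hH1 : HamContinuous H) (hH2 : HamCoercive H) (hH3 : HamConvex H) (hH4 : HamLipschitz H)
    (T : EReal) (hT : 0 < T) (v w : M × ℝ → EReal)
    (hv : IsLSC v (halfOpenCyl M T)) (hw : IsLSC w (halfOpenCyl M T))
    (hvsub : IsBJSubsolution H T v) (hwsup : IsBJSupersolution H T w)
    (hinit : ∀ x : M, liminf (fun t : ℝ => v (x, t)) (𝓝[>] (0 : ℝ)) ≤ w (x, 0)) :
    ∀ z ∈ halfOpenCyl M T, v z ≤ w z := by
  rintro ⟨x, t⟩ hxt
  have hwbot := hw.2 (x, t) hxt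
  obtain ⟨ht0, htT⟩ : 0 ≤ t ∧ (t : EReal) < T := hxt
  obtain ⟨Λ, hΛ, hH4⟩ := hH4
  induction hwm : w (x, t) with
  | bot => exact absurd hwm hwbot
  | top => exact le_top
  | coe m =>
    obtain ⟨T', htT', hT'⟩ := EReal.lt_iff_exists_real_btwn.1 htT
    rw [EReal.coe_lt_coe_iff] at htT'
    have hT'0 : 0 < T' := ht0.trans_lt htT'
    have hsub : {z : M × ℝ | z.2 ∈ Icc 0 T'} ⊆ halfOpenCyl M T := fun z hz =>
      ⟨hz.1, (EReal.coe_le_coe_iff.2 hz.2).trans_lt hT'⟩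
    have hv' : IsLSC v {z : M × ℝ | z.2 ∈ Icc 0 T'} :=
      ⟨hv.1.mono hsub, fun z hz => hv.2 z (hsub hz)⟩
    have hw' : IsLSC w {z : M × ℝ | z.2 ∈ Icc 0 T'} :=
      ⟨hw.1.mono hsub, fun z hz => hw.2 z (hsub hz)⟩
    obtain ⟨H0, hH0⟩ := exists_forall_zero_le hH1
    -- Makes `ψ` at least `max m (|H0| / Λ) + 1` up to time `T'`. Of the decay rate `2 * Λ`, one `Λ`
    -- absorbs the dependence of `H` on `u` and the other absorbs `H0`; exceeding `m` makes the
    -- truncation of `v` harmless at `(x, t)`.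
    set A : ℝ := (max m (|H0| / Λ) + 1) * Real.exp (2 * Λ * T') with hA
    have hmax : 0 ≤ max m (|H0| / Λ) := le_max_of_le_right (by positivity)
    have hA0 : 0 < A := by positivity
    set ψ : ℝ → ℝ := fun s => A * Real.exp (-(2 * Λ * s)) with hψ
    have hψlarge : ∀ s, s ≤ T' → max m (|H0| / Λ) + 1 ≤ ψ s := fun s hs => by
      have h1 : 1 ≤ Real.exp (2 * Λ * T') * Real.exp (-(2 * Λ * s)) := by
        rw [← Real.exp_add, Real.one_le_exp_iff]
        have := mul_le_mul_of_nonneg_left hs (show 0 ≤ 2 * Λ by positivity)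
        linarith
      simp only [hψ, hA, mul_assoc (max m (|H0| / Λ) + 1)]
      exact le_mul_of_one_le_right (by positivity) h1
    have hψA : ∀ s ∈ Icc 0 T', ψ s ≤ A := fun s hs => by
      refine mul_le_of_le_one_right hA0.le (Real.exp_le_one_iff.2 ?_)
      have : 0 ≤ 2 * Λ * s := mul_nonneg (by positivity) hs.1
      linarith
    have hψc : Continuous ψ := by fun_prop
    have hψd : ∀ s, HasDerivAt ψ (-(2 * Λ) * ψ s) s := fun s => by
      have h2 : HasDerivAt (fun s : ℝ => -(2 * Λ * s)) (-(2 * Λ * 1)) s :=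
        ((hasDerivAt_id s).const_mul (2 * Λ)).neg
      refine HasDerivAt.congr_deriv (h2.exp.const_mul A) ?_
      simp only [hψ]
      ring
    have hψH : ∀ s ∈ Icc 0 T', ∀ y, -(2 * Λ) * ψ s + H y 0 (ψ s) ≤ 0 := fun s hs y => by
      have h1 := hψlarge s hs.2
      have h2 : |H0| / Λ ≤ ψ s := by linarith [le_max_right m (|H0| / Λ)]
      rw [div_le_iff₀ hΛ] at h2
      have h3 := (abs_le.1 (hH4 y 0 (ψ s) 0)).2
      rw [sub_zero, abs_of_nonneg (by linarith)] at h3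
      linarith [hH0 y, le_abs_self H0]
    set f := truncation v ψ T' A with hf
    have hflsc : LowerSemicontinuous f := lowerSemicontinuous_truncation hv' hψc hψA
    have hfA : ∀ z, f z ≤ A := truncation_le hv'.2 hψA
    obtain ⟨c, hc⟩ := exists_le_truncation (R := A) hv' hψc
    set R : ℝ := max |c| A with hRmax
    have hR : ∀ z, |f z| ≤ R := fun z => by
      rw [abs_le]
      refine ⟨?_, (hfA z).trans (le_max_right _ _)⟩
      have h1 : -R ≤ -|c| := neg_le_neg (le_max_left _ _)
      linarith [hc z, neg_abs_le c]
    have hfsub : IsProxSubsolution H (Ioo 0 T') f :=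
      hvsub.isProxSubsolution_truncation hT' hv'.2 hψd hψH
    -- Strictly above the bound of `f`, so that `g` is untruncated wherever it is touched by a
    -- regularised subsolution lowered by a positive function.
    set N : ℝ := R + 1 with hN
    have hRN : R < N := lt_add_one R
    set g := truncation w (fun _ => N) T' N with hg
    have hglsc : LowerSemicontinuous g :=
      lowerSemicontinuous_truncation hw' continuous_const fun _ _ => le_rfl
    have hgsup : IsProxSupersolution H (Ioo 0 T') N g :=
      hwsup.isProxSupersolution_truncation hT' hw'.2
    obtain ⟨C₀, hC₀⟩ := hfsub.exists_le_add_mul hH1 hH2 hflsc hR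
    set C : ℝ := max C₀ 0 with hC
    have hdom : ∀ y r s, 0 < r → r ≤ s → s < T' → f (y, s) ≤ f (y, r) + C * (s - r) :=
      fun y r s h1 h2 h3 => (hC₀ y r s h1 h2 h3).trans <| by
        have : 0 ≤ s - r := by linarith
        gcongr
        exact le_max_left _ _
    have hinit' : ∀ y, ∀ s ∈ Ioo 0 T', f (y, s) ≤ g (y, 0) + C * s := by
      intro y s hs
      have hCs : 0 ≤ C * s := mul_nonneg (le_max_right _ _) hs.1.le
      have hg0 : ((g (y, 0) : ℝ) : EReal) = min (w (y, 0)) (N : ℝ) :=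
        coe_truncation hw'.2 (z := (y, 0)) ⟨le_rfl, hT'0.le⟩
      rcases le_or_gt (w (y, 0)) (N : ℝ) with hle | hlt
      · rw [min_eq_left hle] at hg0
        refine le_of_forall_pos_le_add fun ε hε => ?_
        have h1 : liminf (fun t : ℝ => v (y, t)) (𝓝[>] (0 : ℝ)) < ((g (y, 0) + ε : ℝ) : EReal) := by
          refine (hinit y).trans_lt ?_
          rw [← hg0, EReal.coe_lt_coe_iff]
          linarith
        -- The liminf provides arbitrarily small times at which `f` is almost below `g (y, 0)`;
        -- linear growth carries this bound to the time `s`.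
        have h2 : ∃ᶠ r in 𝓝[>] (0 : ℝ), v (y, r) < ((g (y, 0) + ε : ℝ) : EReal) :=
          frequently_lt_of_liminf_lt (by isBoundedDefault) h1
        have h3 : ∀ᶠ r in 𝓝[>] (0 : ℝ), r ∈ Ioo 0 s := Ioo_mem_nhdsGT hs.1
        obtain ⟨r, hr, hrs⟩ := (h2.and_eventually h3).exists
        have hfr : f (y, r) < g (y, 0) + ε := by
          rw [← EReal.coe_lt_coe_iff, hf,
            coe_truncation hv'.2 (z := (y, r)) ⟨hrs.1.le, (hrs.2.trans hs.2).le⟩]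
          exact (min_le_left _ _).trans_lt hr
        have h4 := hdom y r s hrs.1 hrs.2.le hs.2
        have h5 : C * (s - r) ≤ C * s :=
          mul_le_mul_of_nonneg_left (by linarith [hrs.1]) (le_max_right _ _)
        linarith
      · rw [min_eq_right hlt.le, EReal.coe_eq_coe_iff] at hg0
        linarith [(abs_le.1 (hR (y, s))).2]
    have hfg : f (x, t) ≤ g (x, t) :=
      hfsub.le_of_isProxSupersolution hH1 hH2 hH3 hΛ hH4 hflsc
        (hA0.le.trans (le_max_right _ _)) hR hglsc hgsup hRN (le_max_right _ _) hinit' x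
        ⟨ht0, htT'⟩
    have ht : t ∈ Icc 0 T' := ⟨ht0, htT'.le⟩
    rw [← EReal.coe_le_coe_iff, hf, hg, coe_truncation hv'.2 (z := (x, t)) ht,
      coe_truncation hw'.2 (z := (x, t)) ht, hwm] at hfg
    rcases min_le_iff.1 (hfg.trans (min_le_left _ _)) with h | h
    · exact h
    · have h1 : ψ t ≤ m := EReal.coe_le_coe_iff.1 h
      linarith [hψlarge t htT'.le, le_max_left m (|H0| / Λ)]
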